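/- All graphs are finite, simple and undirected. For a graph $G$ with adjacency matrix $A(G)$ and diagonal matrix of vertex degrees $D(G)$, let $Q(G)=A(G)+D(G)$ be its signless Laplacian matrix; the $Q$-spectrum of $G$ is the multiset of eigenvalues of $Q(G)$. The graph $G$ is called DQS (determined by its signless Laplacian spectrum) if every graph with the same $Q$-spectrum as $G$ is isomorphic to $G$. Let $K_n$ and $C_n$ denote the complete graph and the cycle on $n$ vertices, let $\cup$ denote disjoint union, let $qK_2$ be the disjoint union of $q$ copies of $K_2$, and let $G\vee H$ be the join of $G$ and $H$, obtained from $G\cup H$ by adding all edges between a vertex of $G$ and a vertex of $H$. **Theorem 1.2.** Let $t\ge 2$ and $q\ge 0$ be integers and let $s_1,\dots,s_t\ge 3$ be integers. If the graph $$K_1\vee (C_{s_1}\cup C_{s_2}\cup\cdots\cup C_{s_t}\cup qK_2)$$ has at least $52$ vertices, that is, if $1+s_1+\cdots+s_t+2q\ge 52$, then it is DQS. -/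

import Mathlib

universe u v w

namespace QSpectra

/-- The disjoint union of a family of graphs: the vertex set is the disjoint union of the vertex
sets, and the adjacent pairs are the pairs adjacent in a common member of the family. -/
def disjointUnion {ι : Type u} {V : ι → Type v} (G : ∀ i, SimpleGraph (V i)) :
    SimpleGraph (Σ i, V i) where
  Adj x y := ∃ (i : ι) (a b : V i), (G i).Adj a b ∧ x = ⟨i, a⟩ ∧ y = ⟨i, b⟩
  symm := ⟨fun _ _ ⟨i, a, b, h, hx, hy⟩ => ⟨i, b, a, h.symm, hy, hx⟩⟩
  loopless := ⟨by
    rintro x ⟨i, a, b, h, rfl, hy⟩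
    cases hy
    exact (G i).loopless.irrefl _ h⟩

/-- The join `G ∨ H`: the disjoint union of `G` and `H`, together with all edges between a vertex
of `G` and a vertex of `H`. -/
def join {V : Type u} {W : Type v} (G : SimpleGraph V) (H : SimpleGraph W) :
    SimpleGraph (V ⊕ W) :=
  (G ⊕g H) ⊔ completeBipartiteGraph V W

open Classical in
/-- The signless Laplacian matrix `Q(G) = A(G) + D(G)` of a finite simple graph. -/
noncomputable def signlessLaplacian {V : Type u} [Fintype V] (G : SimpleGraph V) :
    Matrix V V ℝ :=
  G.adjMatrix ℝ + G.degMatrix ℝ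

open Classical in
/-- The `Q`-spectrum of a finite simple graph: the multiset of the eigenvalues of its signless
Laplacian, each repeated according to its multiplicity. As the matrix is real symmetric, all roots
of its characteristic polynomial are real. -/
noncomputable def qSpectrum {V : Type u} [Fintype V] (G : SimpleGraph V) : Multiset ℝ :=
  (signlessLaplacian G).charpoly.roots

/-- Two finite simple graphs are `Q`-cospectral if they have the same `Q`-spectrum. -/
def QCospectral {V : Type u} {W : Type v} [Fintype V] [Fintype W]
    (G : SimpleGraph V) (H : SimpleGraph W) : Prop :=
  qSpectrum G = qSpectrum H

/-- `G` is determined by its signless Laplacian spectrum: every finite simple graph that is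
`Q`-cospectral with `G` is isomorphic to `G`. -/
def IsDQS {V : Type u} [Fintype V] (G : SimpleGraph V) : Prop :=
  ∀ (W : Type w) [Fintype W] (H : SimpleGraph W), QCospectral H G → Nonempty (H ≃g G)

/-- The graph `K₁ ∨ (C_{s₁} ∪ ⋯ ∪ C_{sₜ} ∪ qK₂)`. -/
def cyclesEdgesCone {t : ℕ} (s : Fin t → ℕ) (q : ℕ) :
    SimpleGraph (Fin 1 ⊕ ((Σ i : Fin t, Fin (s i)) ⊕ (Σ _ : Fin q, Fin 2))) :=
  join (⊤ : SimpleGraph (Fin 1))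
    ((disjointUnion fun i : Fin t => SimpleGraph.cycleGraph (s i)) ⊕g
      (disjointUnion fun _ : Fin q => (⊤ : SimpleGraph (Fin 2))))

end QSpectra

/-!
Write `G = K₁ ∨ (C_{s₁} ∪ ⋯ ∪ C_{sₜ} ∪ qK₂)`, `N = s₁ + ⋯ + sₜ + 2q` and let `H` be cospectral
with `G`. All eigenvalues of `Q(G)` are at least `1`, and exactly one of them exceeds `5`: an
eigenvector for an eigenvalue above `5` is, up to a factor, positive, and two positive vectors are
not orthogonal. The argument transfers this to `H` and recovers the structure of `H` from it.

*Degrees* (`QCospectral.exists_isCone`). Positive semidefiniteness of `Q(H) - 1` forces all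
degrees to be at least `2`. The traces of `Q` and `Q²` give `∑ d` and `∑ d²`, and their ratio
shows that some vertex `v₀` has degree at least `15`, as there are at least `52` vertices. If
another vertex had degree at least `5`, then on the plane spanned by `v₀` and a star around that
vertex `Q(H) - 5` would be positive definite, against the simplicity of the eigenvalue above `5`
(`degree_le_four`). So the other degrees `d` lie in `{2, 3, 4}`, where `(d - 2)(d - 3) ≤ d - 2`,
and the known sums of both sides force `v₀` to be adjacent to all other vertices and their degrees
to be `2` or `3`. Thus `H` is the cone over a union of cycles and paths.

*Paths* (`QCospectral.pathsAreEdges`). Normalise the Perron vector `x` of a cone of this kind to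
have the entry `1` at the apex. At an end of a path `(μ - 3) x ≥ 1`, with equality just for the
paths with two vertices, whereas summing the eigenvalue equations expresses the sum of `x` over
the ends of paths by `μ`, `N` alone. As `G` and `H` share the largest eigenvalue `μ` and have
equally many ends of paths, all paths in `H` are edges.

*Cycle lengths* (`nonempty_iso_of_qCospectral`). It remains to compare two graphs of the form of
`G`. The determinant of a cone factors (`eval_charpoly_join`), whence the unions of the cycles are
themselves cospectral. The adjacency matrix of a union of cycles is `P + P⁻¹` for the permutation
matrix `P` of a rotation `σ`, so the Chebyshev polynomial `C_k` maps it to `P^k + P^{-k}`, whose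
trace is twice the number of fixed points of `σ^k`, that is, twice the sum of the lengths that
divide `k`. These sums determine the lengths.
-/

namespace QSpectra

open Matrix Polynomial

/-! ### Spectra of real symmetric matrices -/

section Spectral

variable {n : Type*} [Fintype n] [DecidableEq n] {M : Matrix n n ℝ}

lemma aeval_diagonal (d : n → ℝ) (p : ℝ[X]) :
    aeval (diagonal d) p = diagonal fun i => p.eval (d i) := by
  have := Polynomial.aeval_algHom_apply (Matrix.diagonalAlgHom (n := n) (α := ℝ) ℝ) d p
  rw [Matrix.diagonalAlgHom_apply, Matrix.diagonalAlgHom_apply] at this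
  rw [this]
  congr 1
  ext i
  rw [Polynomial.aeval_pi_apply]
  simp

lemma trace_aeval_eq_sum_roots (hM : M.IsHermitian) (p : ℝ[X]) :
    (aeval M p).trace = (M.charpoly.roots.map fun μ => p.eval μ).sum := by
  rw [hM.roots_charpoly_eq_eigenvalues, Multiset.map_map]
  set D : Matrix n n ℝ := diagonal hM.eigenvalues with hD
  obtain ⟨U, V, hVU, hMU⟩ : ∃ U V : Matrix n n ℝ, V * U = 1 ∧ M = U * D * V := by
    refine ⟨hM.eigenvectorUnitary, star (hM.eigenvectorUnitary : Matrix n n ℝ), by simp, ?_⟩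
    conv_lhs => rw [hM.spectral_theorem]
    rfl
  have hUV : U * V = 1 := mul_eq_one_comm.1 hVU
  have hconj : aeval M p = U * aeval D p * V := by
    induction p using Polynomial.induction_on' with
    | add p q hp hq => simp [hp, hq, mul_add, add_mul]
    | monomial k a =>
      have hk : M ^ k = U * D ^ k * V := by
        induction k with
        | zero => simp [hUV]
        | succ k ih =>
          rw [pow_succ, ih, pow_succ]
          nth_rewrite 1 [hMU]
          calc _ = U * D ^ k * (V * U) * D * V := by simp only [mul_assoc]
            _ = _ := by rw [hVU]; simp only [mul_assoc, mul_one]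
      rw [aeval_monomial, aeval_monomial, hk]
      simp [Algebra.algebraMap_eq_smul_one, mul_assoc]
  rw [hconj, trace_mul_cycle, hVU, one_mul, hD, aeval_diagonal, trace_diagonal]
  rfl
lemma exists_eigenvector_of_mem_roots {μ : ℝ} (h : μ ∈ M.charpoly.roots) :
    ∃ x : n → ℝ, x ≠ 0 ∧ M *ᵥ x = μ • x := by
  have h1 : (M.charpoly).IsRoot μ := (Polynomial.mem_roots'.1 h).2
  have h2 : (Matrix.scalar n μ - M).det = 0 := by
    rw [← Matrix.eval_charpoly]; exact h1
  obtain ⟨x, hx, hx'⟩ := Matrix.exists_mulVec_eq_zero_iff.2 h2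
  refine ⟨x, hx, ?_⟩
  rw [Matrix.sub_mulVec, sub_eq_zero] at hx'
  rw [← hx']
  ext i
  simp [Matrix.scalar_apply, Matrix.mulVec_diagonal]

/-- The eigenvectors of a real symmetric matrix, as an orthonormal family for `⬝ᵥ`, and the
diagonal form of the quadratic form in the coordinates that they define. -/
lemma exists_eigenvectors (hM : M.IsHermitian) : ∃ u : n → n → ℝ,
    (∀ i, M *ᵥ u i = hM.eigenvalues i • u i) ∧ (∀ i j, u i ⬝ᵥ u j = if i = j then 1 else 0) ∧
    (∀ z, z ⬝ᵥ z = ∑ i, (u i ⬝ᵥ z) ^ 2) ∧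
    (∀ z, z ⬝ᵥ M *ᵥ z = ∑ i, hM.eigenvalues i * (u i ⬝ᵥ z) ^ 2) := by
  have hin : ∀ x y : EuclideanSpace ℝ n, inner ℝ x y = x.ofLp ⬝ᵥ y.ofLp := by
    intro x y
    rw [EuclideanSpace.inner_eq_star_dotProduct, dotProduct_comm]; simp
  let b := hM.eigenvectorBasis
  have hpar : ∀ x y : n → ℝ, x ⬝ᵥ y = ∑ i, ((b i).ofLp ⬝ᵥ x) * ((b i).ofLp ⬝ᵥ y) := by
    intro x y
    have := b.sum_inner_mul_inner (WithLp.toLp 2 x) (WithLp.toLp 2 y)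
    simp only [hin] at this
    rw [← this]
    exact Finset.sum_congr rfl fun i _ => by rw [dotProduct_comm x]
  have heig : ∀ i, M *ᵥ (b i).ofLp = hM.eigenvalues i • (b i).ofLp :=
    fun i => hM.mulVec_eigenvectorBasis i
  refine ⟨fun i => (b i).ofLp, heig, fun i j => ?_, fun z => ?_, fun z => ?_⟩
  · rw [← hin]; exact orthonormal_iff_ite.1 b.orthonormal i j
  · rw [hpar]; simp [sq]
  · rw [hpar]
    refine Finset.sum_congr rfl fun i _ => ?_
    have : (b i).ofLp ⬝ᵥ M *ᵥ z = hM.eigenvalues i * ((b i).ofLp ⬝ᵥ z) := by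
      rw [dotProduct_mulVec, ← mulVec_transpose,
        show Mᵀ = M from by simpa using hM.eq, heig, smul_dotProduct, smul_eq_mul]
    rw [this]; ring

lemma le_dotProduct_mulVec_of_le_roots (hM : M.IsHermitian) {c : ℝ}
    (h : ∀ μ ∈ M.charpoly.roots, c ≤ μ) (z : n → ℝ) : c * (z ⬝ᵥ z) ≤ z ⬝ᵥ M *ᵥ z := by
  obtain ⟨u, -, -, h1, h2⟩ := exists_eigenvectors hM
  rw [h1, h2, Finset.mul_sum]
  refine Finset.sum_le_sum fun i _ => mul_le_mul_of_nonneg_right (h _ ?_) (sq_nonneg _)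
  rw [hM.roots_charpoly_eq_eigenvalues]
  exact Multiset.mem_map.2 ⟨i, Finset.mem_univ _, rfl⟩

open scoped Classical in
lemma card_filter_roots (hM : M.IsHermitian) (c : ℝ) :
    (M.charpoly.roots.filter (c < ·)).card
      = (Finset.univ.filter fun i => c < hM.eigenvalues i).card := by
  rw [hM.roots_charpoly_eq_eigenvalues, Multiset.filter_map, Multiset.card_map]
  rfl

open scoped Classical in
/-- If at most one eigenvalue exceeds `c`, the form `M - c` is not positive definite on any plane:
the plane meets the hyperplane orthogonal to the exceptional eigenvector. -/
lemma exists_combination_le_of_card_roots_le_one (hM : M.IsHermitian) {c : ℝ}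
    (h : (M.charpoly.roots.filter (c < ·)).card ≤ 1) (x y : n → ℝ) :
    ∃ a b : ℝ, (a ≠ 0 ∨ b ≠ 0) ∧
      (a • x + b • y) ⬝ᵥ M *ᵥ (a • x + b • y) ≤ c * ((a • x + b • y) ⬝ᵥ (a • x + b • y)) := by
  obtain ⟨u, -, -, h1, h2⟩ := exists_eigenvectors hM
  rw [card_filter_roots hM] at h
  have key : ∀ z : n → ℝ, (∀ i, c < hM.eigenvalues i → u i ⬝ᵥ z = 0) →
      z ⬝ᵥ M *ᵥ z ≤ c * (z ⬝ᵥ z) := by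
    intro z hz
    rw [h1, h2, Finset.mul_sum]
    refine Finset.sum_le_sum fun i _ => ?_
    by_cases hi : c < hM.eigenvalues i
    · simp [hz i hi]
    · exact mul_le_mul_of_nonneg_right (not_lt.1 hi) (sq_nonneg _)
  by_cases hex : ∃ i, c < hM.eigenvalues i
  · obtain ⟨i, hi⟩ := hex
    have huniq : ∀ j, c < hM.eigenvalues j → j = i := fun j hj =>
      Finset.card_le_one.1 h j (by simpa using hj) i (by simpa using hi)
    by_cases hx : u i ⬝ᵥ x = 0
    · refine ⟨1, 0, by simp, key _ fun j hj => ?_⟩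
      rw [huniq j hj]; simp [hx]
    · refine ⟨-(u i ⬝ᵥ y), u i ⬝ᵥ x, Or.inr hx, key _ fun j hj => ?_⟩
      rw [huniq j hj]
      simp only [dotProduct_add, dotProduct_smul, smul_eq_mul]; ring
  · push Not at hex
    exact ⟨1, 0, by simp, key _ fun i hi => absurd (hex i) (not_le.2 hi)⟩

open scoped Classical in
/-- If all eigenvectors for eigenvalues above `c` are nonzero multiples of positive vectors, then
there is at most one such eigenvalue, since two orthogonal vectors cannot both be of this kind. -/
lemma card_roots_le_one_of_eigenvectors_pos (hM : M.IsHermitian) {c : ℝ}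
    (h : ∀ μ, c < μ → ∀ x : n → ℝ, x ≠ 0 → M *ᵥ x = μ • x →
      ∃ a : ℝ, a ≠ 0 ∧ ∀ i, 0 < a * x i) :
    (M.charpoly.roots.filter (c < ·)).card ≤ 1 := by
  obtain ⟨u, h0, h1, -, -⟩ := exists_eigenvectors hM
  rw [card_filter_roots hM]
  refine Finset.card_le_one.2 fun i hi j hj => ?_
  by_contra hij
  have hne : ∀ k, u k ≠ 0 := fun k hk => by simpa [hk] using h1 k k
  obtain ⟨a, ha, hax⟩ := h _ (Finset.mem_filter.1 hi).2 _ (hne i) (h0 i)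
  obtain ⟨b, hb, hbx⟩ := h _ (Finset.mem_filter.1 hj).2 _ (hne j) (h0 j)
  have hz : a * b * (u i ⬝ᵥ u j) = 0 := by rw [h1, if_neg hij, mul_zero]
  have hp : 0 < ∑ k, (a * u i k) * (b * u j k) :=
    Finset.sum_pos (fun k _ => mul_pos (hax k) (hbx k)) ⟨i, Finset.mem_univ _⟩
  have : ∑ k, (a * u i k) * (b * u j k) = a * b * (u i ⬝ᵥ u j) := by
    rw [dotProduct, Finset.mul_sum]
    exact Finset.sum_congr rfl fun k _ => by ring
  linarith

lemma exists_root_ge_diag (hM : M.IsHermitian) (i : n) : ∃ μ ∈ M.charpoly.roots, M i i ≤ μ := by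
  by_contra! hcon
  obtain ⟨u, -, -, h1, h2⟩ := exists_eigenvectors hM
  have hmem : ∀ j, hM.eigenvalues j < M i i := fun j => hcon _ (by
    rw [hM.roots_charpoly_eq_eigenvalues]
    exact Multiset.mem_map.2 ⟨j, Finset.mem_univ _, rfl⟩)
  have e1 := h1 (Pi.single i 1)
  have e2 := h2 (Pi.single i 1)
  simp only [mulVec_single_one, single_one_dotProduct, Pi.single_eq_same, col_apply] at e1 e2
  have hlt : ∑ j, hM.eigenvalues j * (u j ⬝ᵥ Pi.single i 1) ^ 2
      < ∑ j, M i i * (u j ⬝ᵥ Pi.single i 1) ^ 2 := by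
    refine Finset.sum_lt_sum (fun j _ => mul_le_mul_of_nonneg_right (hmem j).le (sq_nonneg _)) ?_
    by_contra! hc
    have : ∀ j, (u j ⬝ᵥ Pi.single i (1 : ℝ)) ^ 2 = 0 := fun j => by
      have := hc j (Finset.mem_univ _)
      nlinarith [hmem j, sq_nonneg (u j ⬝ᵥ Pi.single i (1 : ℝ))]
    rw [Finset.sum_congr rfl fun j _ => this j] at e1
    simp at e1
  rw [← e2, ← Finset.mul_sum, ← e1] at hlt
  linarith

end Spectral

/-! ### The signless Laplacian and its spectral invariants -/

section SignlessLaplacian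

open scoped Classical

variable {V : Type*} [Fintype V] (G : SimpleGraph V)

/-- The characteristic polynomial of the signless Laplacian. -/
noncomputable def qPoly : ℝ[X] := (signlessLaplacian G).charpoly

lemma qPoly_eq [DecidableEq V] : qPoly G = (signlessLaplacian G).charpoly := by
  unfold qPoly
  congr!

lemma isHermitian_signlessLaplacian : (signlessLaplacian G).IsHermitian := by
  ext i j
  simp [signlessLaplacian, SimpleGraph.degMatrix, Matrix.diagonal_apply, SimpleGraph.adj_comm]
  by_cases h : i = j
  · subst h; rfl
  · simp [h, Ne.symm h]

lemma signlessLaplacian_apply (u v : V) : signlessLaplacian G u v =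
    (if G.Adj u v then 1 else 0) + if u = v then (G.degree u : ℝ) else 0 := by
  simp [signlessLaplacian, SimpleGraph.degMatrix, Matrix.diagonal_apply]

lemma signlessLaplacian_apply_self (v : V) : signlessLaplacian G v v = G.degree v := by
  simp [signlessLaplacian_apply]

lemma signlessLaplacian_mulVec_apply (x : V → ℝ) (v : V) :
    (signlessLaplacian G *ᵥ x) v = G.degree v * x v + ∑ u ∈ G.neighborFinset v, x u := by
  simp [signlessLaplacian, Matrix.add_mulVec, SimpleGraph.degMatrix, Matrix.mulVec_diagonal,
    add_comm]

lemma trace_signlessLaplacian : (signlessLaplacian G).trace = ∑ v, (G.degree v : ℝ) := by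
  simp [Matrix.trace, signlessLaplacian_apply]

lemma trace_signlessLaplacian_sq :
    (signlessLaplacian G ^ 2).trace = ∑ v, ((G.degree v : ℝ) ^ 2 + G.degree v) := by
  rw [Matrix.trace]
  refine Finset.sum_congr rfl fun v _ => ?_
  have h1 : (signlessLaplacian G ^ 2) v v
      = (signlessLaplacian G *ᵥ fun u => signlessLaplacian G u v) v := by
    rw [sq]; rfl
  rw [diag_apply, h1, signlessLaplacian_mulVec_apply, signlessLaplacian_apply_self, sq,
    Finset.sum_congr rfl (g := fun _ => (1 : ℝ))]
  · simp
  · intro u hu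
    rw [SimpleGraph.mem_neighborFinset] at hu
    simp [signlessLaplacian_apply, hu.symm, hu.ne']

variable {G} {W : Type*} [Fintype W] {H : SimpleGraph W}

lemma QCospectral.roots_eq (h : QCospectral H G) :
    (signlessLaplacian H).charpoly.roots = (signlessLaplacian G).charpoly.roots := h

lemma QCospectral.qPoly_eq (h : QCospectral H G) :
    qPoly H = qPoly G := by
  have h1 := (isHermitian_signlessLaplacian H).splits_charpoly
  have h2 := (isHermitian_signlessLaplacian G).splits_charpoly
  rw [qPoly, qPoly, h1.eq_prod_roots_of_monic (charpoly_monic _),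
    h2.eq_prod_roots_of_monic (charpoly_monic _),
    h.roots_eq]

lemma QCospectral.card_eq (h : QCospectral H G) : Fintype.card W = Fintype.card V := by
  have := congrArg natDegree h.qPoly_eq
  simpa [qPoly, charpoly_natDegree_eq_dim] using this

lemma QCospectral.sum_degree_eq (h : QCospectral H G) :
    ∑ v, (H.degree v : ℝ) = ∑ v, (G.degree v : ℝ) := by
  have h1 := trace_aeval_eq_sum_roots (isHermitian_signlessLaplacian H) X
  have h2 := trace_aeval_eq_sum_roots (isHermitian_signlessLaplacian G) X
  rw [h.roots_eq, ← h2, aeval_X, aeval_X, trace_signlessLaplacian, trace_signlessLaplacian] at h1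
  exact h1

lemma QCospectral.sum_degree_sq_eq (h : QCospectral H G) :
    ∑ v, (H.degree v : ℝ) ^ 2 = ∑ v, (G.degree v : ℝ) ^ 2 := by
  have h1 := trace_aeval_eq_sum_roots (isHermitian_signlessLaplacian H) (X ^ 2)
  have h2 := trace_aeval_eq_sum_roots (isHermitian_signlessLaplacian G) (X ^ 2)
  simp only [map_pow, aeval_X, trace_signlessLaplacian_sq, Finset.sum_add_distrib] at h1 h2
  rw [h.roots_eq, ← h2, h.sum_degree_eq] at h1
  exact add_right_cancel h1

lemma QCospectral.of_iso (e : H ≃g G) : QCospectral H G := by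
  have : signlessLaplacian G = reindex e.toEquiv e.toEquiv (signlessLaplacian H) := by
    ext i j
    simp only [reindex_apply, submatrix_apply, signlessLaplacian_apply]
    have h1 : H.Adj (e.toEquiv.symm i) (e.toEquiv.symm j) ↔ G.Adj i j := e.symm.map_rel_iff'
    have h2 : H.degree (e.toEquiv.symm i) = G.degree i := e.symm.degree_eq i
    simp only [h1, h2, EmbeddingLike.apply_eq_iff_eq]
  unfold QCospectral qSpectrum
  rw [this, charpoly_reindex]

end SignlessLaplacian

/-! ### Degrees of graphs with one eigenvalue above 5 -/

section DegreeBounds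

open scoped Classical

variable {V : Type*} [Fintype V] {G : SimpleGraph V}

/-- If every signless Laplacian eigenvalue is at least `1`, a vertex of degree at most `1` would
give a zero diagonal entry of a positive semidefinite matrix in a nonzero row. -/
lemma two_le_degree (h : ∀ z : V → ℝ, z ⬝ᵥ z ≤ z ⬝ᵥ signlessLaplacian G *ᵥ z) (v : V) :
    2 ≤ G.degree v := by
  by_contra! hv
  have hv' : G.degree v = 0 ∨ G.degree v = 1 := by omega
  rcases hv' with h0 | h1
  · have := h (Pi.single v 1)
    simp [signlessLaplacian_apply_self, h0] at this
    linarith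
  · obtain ⟨w, hw, -⟩ := SimpleGraph.degree_eq_one_iff_existsUnique_adj.1 h1
    have := h ((G.degree w : ℝ) • Pi.single v 1 - Pi.single w 1)
    have hvw : signlessLaplacian G v w = 1 := by simp [signlessLaplacian_apply, hw, hw.ne]
    have hwv : signlessLaplacian G w v = 1 := by simp [signlessLaplacian_apply, hw.symm, hw.ne']
    simp [mulVec_sub, mulVec_smul, sub_dotProduct, dotProduct_sub,
      signlessLaplacian_apply_self, h1, hvw, hwv, hw.ne, hw.ne'] at this
    have hd : (1 : ℝ) ≤ G.degree w := by
      exact_mod_cast hw.symm.degree_pos_left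
    nlinarith

/-- If the form `M - c` takes a nonpositive value on the plane of `x` and `y` but is
positive at `x`, then its Gram determinant on `x`, `y` is nonpositive. -/
lemma mul_le_sq_of_exists_combination_le {M : Matrix V V ℝ} (hM : M.IsHermitian) {c : ℝ}
    {x y : V → ℝ} (h : ∃ a b : ℝ, (a ≠ 0 ∨ b ≠ 0) ∧
      (a • x + b • y) ⬝ᵥ M *ᵥ (a • x + b • y) ≤ c * ((a • x + b • y) ⬝ᵥ (a • x + b • y)))
    (hx : 0 < x ⬝ᵥ M *ᵥ x - c * (x ⬝ᵥ x)) :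
    (x ⬝ᵥ M *ᵥ x - c * (x ⬝ᵥ x)) * (y ⬝ᵥ M *ᵥ y - c * (y ⬝ᵥ y))
      ≤ (x ⬝ᵥ M *ᵥ y - c * (x ⬝ᵥ y)) ^ 2 := by
  obtain ⟨a, b, hab, hle⟩ := h
  have hsymm : y ⬝ᵥ M *ᵥ x = x ⬝ᵥ M *ᵥ y := by
    rw [dotProduct_mulVec, ← mulVec_transpose, show Mᵀ = M from by simpa using hM.eq,
      dotProduct_comm]
  simp only [mulVec_add, mulVec_smul, add_dotProduct, dotProduct_add, smul_dotProduct,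
    dotProduct_smul, smul_eq_mul, hsymm, dotProduct_comm y x] at hle
  set p := x ⬝ᵥ M *ᵥ x - c * (x ⬝ᵥ x) with hp
  set r := y ⬝ᵥ M *ᵥ y - c * (y ⬝ᵥ y) with hr
  set s := x ⬝ᵥ M *ᵥ y - c * (x ⬝ᵥ y) with hs
  have hle' : a ^ 2 * p + 2 * a * b * s + b ^ 2 * r ≤ 0 := by rw [hp, hr, hs]; linarith
  by_contra! hcon
  -- complete the square: `p` times the form is `(a p + b s)² + b² (p r - s²)`
  have h1 : (a * p + b * s) ^ 2 + b ^ 2 * (p * r - s ^ 2) ≤ 0 := by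
    have := mul_nonpos_of_nonneg_of_nonpos hx.le hle'
    linarith
  have hb : b = 0 := by
    by_contra hb
    have : 0 < b ^ 2 * (p * r - s ^ 2) := mul_pos (by positivity) (by linarith)
    nlinarith [sq_nonneg (a * p + b * s)]
  have ha : a ≠ 0 := by simpa [hb] using hab
  subst hb
  have : 0 < a ^ 2 * p := mul_pos (by positivity) hx
  linarith

/-- A vertex `u` of degree at least `5` other than `v₀`, together with four of its other
neighbours, supports a vector on which `Q - 5` takes a value so large that `Q` would have two
eigenvalues above `5`. -/
lemma degree_le_four {v₀ u : V} (hu : u ≠ v₀) (h₀ : 15 ≤ G.degree v₀)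
    (hdeg : ∀ v, 2 ≤ G.degree v)
    (h : ((signlessLaplacian G).charpoly.roots.filter ((5 : ℝ) < ·)).card ≤ 1) :
    G.degree u ≤ 4 := by
  by_contra! h5
  obtain ⟨S, hS, hScard⟩ : ∃ S ⊆ (G.neighborFinset u).erase v₀, S.card = 4 := by
    apply Finset.exists_subset_card_eq
    have := Finset.pred_card_le_card_erase (s := G.neighborFinset u) (a := v₀)
    rw [SimpleGraph.card_neighborFinset_eq_degree] at this
    omega
  have huS : u ∉ S := fun hu => by simpa using hS hu
  have h0S : v₀ ∉ S := fun hu => by simpa using hS hu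
  have hadj : ∀ w ∈ S, G.Adj u w := fun w hw => by
    have := hS hw
    simp at this; exact this.2
  let y : V → ℝ := fun v => if v = u then 2 else if v ∈ S then 1 else 0
  have hy0 : ∀ v, 0 ≤ y v := fun v => by simp only [y]; split_ifs <;> norm_num
  have hyu : y u = 2 := by simp [y]
  have hyS : ∀ w ∈ S, y w = 1 := fun w hw => by
    have : w ≠ u := fun e => huS (e ▸ hw)
    simp [y, this, hw]
  have hy_out : ∀ v, v ∉ insert u S → y v = 0 := fun v hv => by
    simp only [Finset.mem_insert, not_or] at hv
    simp [y, hv]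
  have hdot : ∀ f : V → ℝ, y ⬝ᵥ f = 2 * f u + ∑ w ∈ S, f w := by
    intro f
    rw [dotProduct, ← Finset.sum_subset (Finset.subset_univ (insert u S)) fun v _ hv => by
      rw [hy_out v hv, zero_mul], Finset.sum_insert huS, hyu]
    congr 1
    exact Finset.sum_congr rfl fun w hw => by rw [hyS w hw, one_mul]
  have hsum : ∑ v, y v = 6 := by
    have := hdot 1
    simp [hScard] at this
    rw [← dotProduct_one, this]; norm_num
  have hyy : y ⬝ᵥ y = 8 := by
    rw [hdot, hyu, Finset.sum_congr rfl hyS]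
    simp [hScard]; norm_num
  have hQu : 14 ≤ (signlessLaplacian G *ᵥ y) u := by
    rw [signlessLaplacian_mulVec_apply, hyu]
    have h1 : ∑ w ∈ S, y w ≤ ∑ w ∈ G.neighborFinset u, y w :=
      Finset.sum_le_sum_of_subset_of_nonneg
        (fun w hw => (SimpleGraph.mem_neighborFinset _ _ _).2 (hadj w hw)) fun w _ _ => hy0 w
    rw [Finset.sum_congr rfl hyS] at h1
    simp [hScard] at h1
    have : (5 : ℝ) ≤ G.degree u := by exact_mod_cast h5
    linarith
  have hQS : ∀ w ∈ S, 4 ≤ (signlessLaplacian G *ᵥ y) w := by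
    intro w hw
    rw [signlessLaplacian_mulVec_apply, hyS w hw]
    have h1 : y u ≤ ∑ v ∈ G.neighborFinset w, y v :=
      Finset.single_le_sum (fun v _ => hy0 v)
        ((SimpleGraph.mem_neighborFinset _ _ _).2 (hadj w hw).symm)
    have : (2 : ℝ) ≤ G.degree w := by exact_mod_cast hdeg w
    linarith
  have hyQy : 44 ≤ y ⬝ᵥ signlessLaplacian G *ᵥ y := by
    rw [hdot]
    have := Finset.card_nsmul_le_sum S _ 4 hQS
    simp [hScard] at this
    linarith
  have hy_v₀ : y v₀ = 0 := hy_out _ (by simp [h0S, hu.symm])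
  have hQ0 : (signlessLaplacian G *ᵥ y) v₀ = ∑ v ∈ G.neighborFinset v₀, y v := by
    rw [signlessLaplacian_mulVec_apply, hy_v₀]; simp
  have hQ0' : (signlessLaplacian G *ᵥ y) v₀ ≤ 6 := by
    rw [hQ0, ← hsum]
    exact Finset.sum_le_sum_of_subset_of_nonneg (Finset.subset_univ _) fun v _ _ => hy0 v
  have hQ0'' : 0 ≤ (signlessLaplacian G *ᵥ y) v₀ := by
    rw [hQ0]; exact Finset.sum_nonneg fun v _ => hy0 v
  have h0' : (15 : ℝ) ≤ G.degree v₀ := by exact_mod_cast h₀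
  have key := mul_le_sq_of_exists_combination_le (isHermitian_signlessLaplacian G)
    (exists_combination_le_of_card_roots_le_one (isHermitian_signlessLaplacian G) h
      (Pi.single v₀ 1) y)
  simp [signlessLaplacian_apply_self, hy_v₀, hyy] at key
  -- `(15 - 5) (44 - 5 · 8) > 6²`
  nlinarith [key (by linarith)]

/-- Over the vertices other than `v₀`, whose degrees are `2`, `3` or `4`, the sum of
`(d - 2)(d - 3)` is at most that of `d - 2`. If `v₀` missed a vertex, the former
sum would be too large, as the two total sums are known; hence it is zero. -/
lemma degree_eq_of_sums {v₀ : V} {b : ℝ} (hcard : 52 ≤ Fintype.card V)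
    (hb : b ≤ Fintype.card V - 1)
    (h₀ : 15 ≤ G.degree v₀) (hdeg : ∀ v, 2 ≤ G.degree v) (hdeg' : ∀ v, v ≠ v₀ → G.degree v ≤ 4)
    (h1 : ∑ v, ((G.degree v : ℝ) - 2) = (Fintype.card V - 3) + b)
    (h2 : ∑ v, ((G.degree v : ℝ) - 2) * ((G.degree v : ℝ) - 3)
      = (Fintype.card V - 3) * (Fintype.card V - 4)) :
    (∀ v, v ≠ v₀ → G.Adj v₀ v) ∧ ∀ v, v ≠ v₀ → G.degree v = 2 ∨ G.degree v = 3 := by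
  rw [← Finset.add_sum_erase _ _ (Finset.mem_univ v₀)] at h1 h2
  have hlt : (G.degree v₀ : ℝ) + 1 ≤ Fintype.card V := by
    exact_mod_cast G.degree_lt_card_verts v₀
  have hcases : ∀ v ∈ Finset.univ.erase v₀, G.degree v = 2 ∨ G.degree v = 3 ∨ G.degree v = 4 :=
    fun v hv => by
      have := hdeg v; have := hdeg' v (Finset.ne_of_mem_erase hv); omega
  have hle : ∑ v ∈ Finset.univ.erase v₀, ((G.degree v : ℝ) - 2) * ((G.degree v : ℝ) - 3)
      ≤ ∑ v ∈ Finset.univ.erase v₀, ((G.degree v : ℝ) - 2) := by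
    refine Finset.sum_le_sum fun v hv => ?_
    rcases hcases v hv with h | h | h <;> rw [h] <;> norm_num
  have hcard' : (52 : ℝ) ≤ Fintype.card V := by exact_mod_cast hcard
  have h0' : (15 : ℝ) ≤ G.degree v₀ := by exact_mod_cast h₀
  have hfull : G.degree v₀ + 1 = Fintype.card V := by
    by_contra hne
    have hlt' : G.degree v₀ + 2 ≤ Fintype.card V := by
      have := G.degree_lt_card_verts v₀; omega
    have hlt'' : (G.degree v₀ : ℝ) + 2 ≤ Fintype.card V := by exact_mod_cast hlt'
    nlinarith [mul_nonneg (sub_nonneg.2 hlt'') (sub_nonneg.2 h0')]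
  have hfull' : (G.degree v₀ : ℝ) + 1 = Fintype.card V := by exact_mod_cast hfull
  constructor
  · intro v hv
    have hsub : G.neighborFinset v₀ ⊆ Finset.univ.erase v₀ := fun w hw => by
      simpa using ((SimpleGraph.mem_neighborFinset _ _ _).1 hw).ne'
    have := Finset.eq_of_subset_of_card_le hsub (by
      rw [Finset.card_erase_of_mem (Finset.mem_univ _), Finset.card_univ,
        SimpleGraph.card_neighborFinset_eq_degree]; omega)
    rw [← SimpleGraph.mem_neighborFinset, this]
    simpa using hv
  · intro v hv
    have hz : ∑ v ∈ Finset.univ.erase v₀, ((G.degree v : ℝ) - 2) * ((G.degree v : ℝ) - 3) = 0 := by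
      rw [← hfull'] at h2; linarith
    have := (Finset.sum_eq_zero_iff_of_nonneg fun v hv => by
      rcases hcases v hv with h | h | h <;> rw [h] <;> norm_num).1 hz v (by simpa using hv)
    rcases hcases v (by simpa using hv) with h | h | h
    · exact Or.inl h
    · exact Or.inr h
    · rw [h] at this; norm_num at this

end DegreeBounds

/-! ### Eigenvectors of cones over unions of paths and cycles -/

section Cone

open scoped Classical

variable {V : Type*} [Fintype V]

/-- `G` is the cone with apex `v₀` over a graph all of whose vertices have degree `1` or `2`. -/
structure IsCone (G : SimpleGraph V) (v₀ : V) : Prop where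
  adj : ∀ v, v ≠ v₀ → G.Adj v₀ v
  degree : ∀ v, v ≠ v₀ → G.degree v = 2 ∨ G.degree v = 3

/-- The components of the base of the cone that are not cycles are single edges: next to a vertex
of degree `2` there is, apart from the apex, only another vertex of degree `2`. -/
def PathsAreEdges (G : SimpleGraph V) (v₀ : V) : Prop :=
  ∀ v w, v ≠ v₀ → w ≠ v₀ → G.Adj v w → G.degree v = 2 → G.degree w = 2

variable {G : SimpleGraph V} {v₀ : V}

namespace IsCone

variable (hG : IsCone G v₀)
include hG

lemma card_erase {v : V} (hv : v ≠ v₀) :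
    ((G.neighborFinset v).erase v₀).card + 1 = G.degree v := by
  rw [← SimpleGraph.card_neighborFinset_eq_degree]
  exact Finset.card_erase_add_one ((SimpleGraph.mem_neighborFinset _ _ _).2 (hG.adj v hv).symm)

lemma mulVec_apply {v : V} (hv : v ≠ v₀) (x : V → ℝ) : (signlessLaplacian G *ᵥ x) v =
    G.degree v * x v + x v₀ + ∑ u ∈ (G.neighborFinset v).erase v₀, x u := by
  rw [signlessLaplacian_mulVec_apply, add_assoc, Finset.add_sum_erase]
  exact (SimpleGraph.mem_neighborFinset _ _ _).2 (hG.adj v hv).symm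

lemma neighborFinset_apex : G.neighborFinset v₀ = Finset.univ.erase v₀ := by
  ext v
  simp only [SimpleGraph.mem_neighborFinset, Finset.mem_erase, Finset.mem_univ, and_true]
  exact ⟨fun h => h.ne', hG.adj v⟩

lemma degree_apex : (G.degree v₀ : ℝ) = Fintype.card V - 1 := by
  have : G.degree v₀ + 1 = Fintype.card V := by
    rw [← SimpleGraph.card_neighborFinset_eq_degree, hG.neighborFinset_apex,
      Finset.card_erase_add_one (Finset.mem_univ _), Finset.card_univ]
  rw [← this]; simp

lemma mulVec_apex (x : V → ℝ) : (signlessLaplacian G *ᵥ x) v₀ =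
    (Fintype.card V - 1) * x v₀ + ∑ u ∈ Finset.univ.erase v₀, x u := by
  rw [signlessLaplacian_mulVec_apply, hG.neighborFinset_apex, hG.degree_apex]

/-- The maximum modulus argument for diagonally dominant systems. -/
lemma eq_zero_of_eigen {μ : ℝ} (hμ : μ < 1 ∨ 5 < μ) {x : V → ℝ} (h0 : x v₀ = 0)
    (hx : ∀ v, v ≠ v₀ → (signlessLaplacian G *ᵥ x) v = μ * x v) : x = 0 := by
  obtain ⟨v, -, hmax⟩ :=
    Finset.exists_max_image Finset.univ (fun v => |x v|) ⟨v₀, Finset.mem_univ _⟩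
  suffices hxv : x v = 0 by
    ext w
    have := hmax w (Finset.mem_univ _)
    rw [hxv, abs_zero] at this
    exact abs_nonpos_iff.1 this
  by_contra hxv
  have hv : v ≠ v₀ := fun e => hxv (e ▸ h0)
  have h1 := hx v hv
  rw [hG.mulVec_apply hv, h0, add_zero] at h1
  have h2 : |(μ - G.degree v) * x v| ≤ (G.degree v - 1) * |x v| := by
    have : (μ - G.degree v) * x v = ∑ u ∈ (G.neighborFinset v).erase v₀, x u := by linarith
    rw [this]
    refine (Finset.abs_sum_le_sum_abs _ _).trans ?_
    refine (Finset.sum_le_card_nsmul _ _ _ fun u _ => hmax u (Finset.mem_univ _)).trans ?_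
    rw [nsmul_eq_mul, ← hG.card_erase hv]; simp
  rw [abs_mul] at h2
  have h3 := le_of_mul_le_mul_right h2 (abs_pos.2 hxv)
  have hd := hG.degree v hv
  rw [abs_le] at h3
  rcases hd with hd | hd <;> rw [hd] at h3 <;> rcases hμ with hμ | hμ <;> norm_num at h3 <;>
    linarith

lemma pos_of_eigen {μ : ℝ} (hμ : 5 < μ) {x : V → ℝ} (h0 : x v₀ = 1)
    (hx : ∀ v, v ≠ v₀ → (signlessLaplacian G *ᵥ x) v = μ * x v) (w : V) : 0 < x w := by
  obtain ⟨v, -, hmin⟩ := Finset.exists_min_image Finset.univ x ⟨v₀, Finset.mem_univ _⟩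
  refine lt_of_lt_of_le ?_ (hmin w (Finset.mem_univ _))
  by_cases hv : v = v₀
  · rw [hv, h0]; norm_num
  have h1 := hx v hv
  rw [hG.mulVec_apply hv, h0] at h1
  have h2 := Finset.card_nsmul_le_sum ((G.neighborFinset v).erase v₀) x (x v)
    fun u _ => hmin u (Finset.mem_univ _)
  rw [nsmul_eq_mul] at h2
  have h3 : ((G.neighborFinset v).erase v₀).card = (G.degree v : ℝ) - 1 := by
    rw [← hG.card_erase hv]; simp
  rw [h3] at h2
  rcases hG.degree v hv with hd | hd <;> rw [hd] at h1 h2 <;> norm_num at h1 h2 <;> nlinarith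

/-- An eigenvector for an eigenvalue outside `[1, 5]` does not vanish at the apex, and may be
normalised there. -/
lemma exists_normalized_eigenvector {μ : ℝ} (hμ : μ < 1 ∨ 5 < μ) {x : V → ℝ} (hx0 : x ≠ 0)
    (hx : signlessLaplacian G *ᵥ x = μ • x) : ∃ a : ℝ, a ≠ 0 ∧ (a • x) v₀ = 1 ∧
      signlessLaplacian G *ᵥ (a • x) = μ • (a • x) := by
  have h0 : x v₀ ≠ 0 := fun h0 => hx0 (hG.eq_zero_of_eigen hμ h0 fun v _ => by rw [hx]; rfl)
  refine ⟨(x v₀)⁻¹, inv_ne_zero h0, by simp [h0], ?_⟩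
  rw [mulVec_smul, hx, smul_comm]

lemma card_roots_le_one :
    ((signlessLaplacian G).charpoly.roots.filter ((5 : ℝ) < ·)).card ≤ 1 := by
  refine card_roots_le_one_of_eigenvectors_pos (isHermitian_signlessLaplacian G)
    fun μ hμ x hx0 hx => ?_
  obtain ⟨a, ha, h1, h2⟩ := hG.exists_normalized_eigenvector (Or.inr hμ) hx0 hx
  exact ⟨a, ha, fun v => hG.pos_of_eigen hμ h1 (fun v _ => by rw [h2]; rfl) v⟩

/-- Summing over the base an expression in the base neighbours of each vertex counts the vertex `u`
once for each of its `deg u - 1` base neighbours. -/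
lemma sum_sum_erase (x : V → ℝ) :
    ∑ v ∈ Finset.univ.erase v₀, ∑ u ∈ (G.neighborFinset v).erase v₀, x u
      = ∑ u ∈ Finset.univ.erase v₀, ((G.degree u : ℝ) - 1) * x u := by
  rw [Finset.sum_comm' (t' := Finset.univ.erase v₀) (s' := fun u => (G.neighborFinset u).erase v₀)]
  · refine Finset.sum_congr rfl fun u hu => ?_
    rw [Finset.sum_const, nsmul_eq_mul, ← hG.card_erase (Finset.ne_of_mem_erase hu)]
    simp
  · intro u v
    simp [SimpleGraph.adj_comm]
    tauto

/-- The sum of the eigenvalue equations over the base: the sum of the normalised eigenvector over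
the ends of the paths depends only on the eigenvalue and the number of vertices. -/
lemma sum_degree_two {μ : ℝ} {x : V → ℝ} (h0 : x v₀ = 1)
    (hx : signlessLaplacian G *ᵥ x = μ • x) :
    2 * ∑ v ∈ (Finset.univ.erase v₀).filter (G.degree · = 2), x v
      = (Fintype.card V - 1) - (μ - 5) * (μ - (Fintype.card V - 1)) := by
  have h1 : ∑ v ∈ Finset.univ.erase v₀, (signlessLaplacian G *ᵥ x) v
      = ∑ v ∈ Finset.univ.erase v₀, μ * x v := by rw [hx]; rfl
  rw [Finset.sum_congr rfl fun v hv => hG.mulVec_apply (Finset.ne_of_mem_erase hv) x,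
    Finset.sum_add_distrib, hG.sum_sum_erase, Finset.sum_add_distrib, h0, Finset.sum_const,
    Finset.card_erase_of_mem (Finset.mem_univ _), Finset.card_univ, nsmul_eq_mul,
    Nat.cast_sub (Fintype.card_pos_iff.2 ⟨v₀⟩), ← Finset.mul_sum] at h1
  have h2 := congrFun hx v₀
  rw [hG.mulVec_apex, h0, Pi.smul_apply, smul_eq_mul, h0] at h2
  have h3 : ∑ v ∈ Finset.univ.erase v₀, (G.degree v : ℝ) * x v
      = 3 * ∑ v ∈ Finset.univ.erase v₀, x v
        - ∑ v ∈ (Finset.univ.erase v₀).filter (G.degree · = 2), x v := by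
    rw [Finset.sum_filter, Finset.mul_sum, ← Finset.sum_sub_distrib]
    refine Finset.sum_congr rfl fun v hv => ?_
    rcases hG.degree v (Finset.ne_of_mem_erase hv) with h | h <;> rw [h] <;> norm_num
    ring
  simp only [sub_mul, one_mul, Finset.sum_sub_distrib, Nat.cast_one, mul_one] at h1
  have h4 : ∑ u ∈ Finset.univ.erase v₀, x u = μ - (Fintype.card V - 1) := by linarith
  rw [h3, h4] at h1
  linarith

/-- The unique base neighbour of a vertex of degree `2`. -/
lemma exists_unique_neighbor {v : V} (hv : v ≠ v₀) (hd : G.degree v = 2) :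
    ∃ w, w ≠ v₀ ∧ G.Adj v w ∧ (G.neighborFinset v).erase v₀ = {w} := by
  have := hG.card_erase hv
  obtain ⟨w, hw⟩ := Finset.card_eq_one.1 (show ((G.neighborFinset v).erase v₀).card = 1 by omega)
  have hmem : w ∈ (G.neighborFinset v).erase v₀ := by rw [hw]; simp
  simp only [Finset.mem_erase, SimpleGraph.mem_neighborFinset] at hmem
  exact ⟨w, hmem.1, hmem.2, hw⟩

lemma eigen_edge {μ : ℝ} {x : V → ℝ} (h0 : x v₀ = 1)
    (hx : signlessLaplacian G *ᵥ x = μ • x) {v w : V} (hv : v ≠ v₀) (hd : G.degree v = 2)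
    (hw : (G.neighborFinset v).erase v₀ = {w}) : (μ - 2) * x v = 1 + x w := by
  have h1 := congrFun hx v
  rw [hG.mulVec_apply hv, hd, h0, hw, Finset.sum_singleton, Pi.smul_apply, smul_eq_mul] at h1
  push_cast at h1
  linarith

/-- At an end of a path the normalised Perron vector is `1 / (μ - 3)` if the path is a single edge,
and larger otherwise. -/
lemma eigen_path_end {μ : ℝ} (hμ : 5 < μ) {x : V → ℝ} (h0 : x v₀ = 1)
    (hx : signlessLaplacian G *ᵥ x = μ • x) {v w : V} (hv : v ≠ v₀) (hw : w ≠ v₀)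
    (hd : G.degree v = 2) (hadj : G.Adj v w) :
    (G.degree w = 2 → (μ - 3) * x v = 1) ∧ (G.degree w = 3 → 1 < (μ - 3) * x v) := by
  have hpos := hG.pos_of_eigen hμ h0 fun v _ => by rw [hx]; rfl
  have hnbr : ∀ a b : V, a ≠ v₀ → b ≠ v₀ → G.degree a = 2 → G.Adj a b →
      (μ - 2) * x a = 1 + x b := by
    intro a b ha hb hda hab
    obtain ⟨c, -, -, hc⟩ := hG.exists_unique_neighbor ha hda
    have : b ∈ (G.neighborFinset a).erase v₀ := by simp [hb, hab]
    rw [hc, Finset.mem_singleton] at this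
    exact hG.eigen_edge h0 hx ha hda (this ▸ hc)
  have h1 := hnbr v w hv hw hd hadj
  refine ⟨fun hdw => ?_, fun hdw => ?_⟩
  · have h2 := hnbr w v hw hv hdw hadj.symm
    have : (μ - 1) * (x v - x w) = 0 := by linarith
    have : x v - x w = 0 := by
      rcases mul_eq_zero.1 this with h | h
      · linarith
      · exact h
    linarith
  · have h2 := congrFun hx w
    rw [hG.mulVec_apply hw, hdw, h0, Pi.smul_apply, smul_eq_mul] at h2
    have h3 : x v ≤ ∑ u ∈ (G.neighborFinset w).erase v₀, x u :=
      Finset.single_le_sum (fun u _ => (hpos u).le) (by simp [hv, hadj.symm])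
    have h4 : x v < ∑ u ∈ (G.neighborFinset w).erase v₀, x u := by
      obtain ⟨u, hu, huv⟩ := Finset.exists_mem_ne (s := (G.neighborFinset w).erase v₀)
        (by have := hG.card_erase hw; omega) v
      exact Finset.single_lt_sum huv (by simp [hv, hadj.symm]) hu (hpos u) fun u _ _ => (hpos u).le
    push_cast at h2
    -- `x w > x v`: otherwise the equations at `v` and `w` contradict each other
    nlinarith [hpos v, hpos w]

/-- Among cones with the same number of vertices and the same number of vertices of degree `2`,
the signless Laplacian spectral radius detects whether all path components of the base are
single edges. -/
lemma pathsAreEdges_of_mem_roots {μ : ℝ} (hμ : 5 < μ)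
    (hroot : μ ∈ (signlessLaplacian G).charpoly.roots)
    (h : (μ - 3) * ((Fintype.card V - 1) - (μ - 5) * (μ - (Fintype.card V - 1)))
      = 2 * ((Finset.univ.erase v₀).filter (G.degree · = 2)).card) : PathsAreEdges G v₀ := by
  obtain ⟨x, hx0, hx⟩ := exists_eigenvector_of_mem_roots hroot
  obtain ⟨a, -, h0, hx⟩ := hG.exists_normalized_eigenvector (Or.inr hμ) hx0 hx
  rw [← hG.sum_degree_two h0 hx, mul_left_comm] at h
  have h' : ∑ v ∈ (Finset.univ.erase v₀).filter (G.degree · = 2),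
      ((μ - 3) * (a • x) v - 1) = 0 := by
    rw [Finset.sum_sub_distrib, ← Finset.mul_sum]
    simp only [Finset.sum_const, nsmul_eq_mul, mul_one]
    linarith
  have hnn : ∀ v ∈ (Finset.univ.erase v₀).filter (G.degree · = 2),
      0 ≤ (μ - 3) * (a • x) v - 1 := by
    intro v hv
    simp only [Finset.mem_filter, Finset.mem_erase, Finset.mem_univ, and_true] at hv
    obtain ⟨w, hw, hvw, -⟩ := hG.exists_unique_neighbor hv.1 hv.2
    have := hG.eigen_path_end hμ h0 hx hv.1 hw hv.2 hvw
    rcases hG.degree w hw with h | h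
    · linarith [this.1 h]
    · linarith [this.2 h]
  intro v w hv hw hvw hd
  by_contra hdw
  have h1 := (hG.eigen_path_end hμ h0 hx hv hw hd hvw).2 ((hG.degree w hw).resolve_left hdw)
  have h2 := (Finset.sum_eq_zero_iff_of_nonneg hnn).1 h' v (by simp [hv, hd])
  linarith

lemma eq_of_mem_roots {μ : ℝ} (hμ : 5 < μ) (hpath : PathsAreEdges G v₀)
    (hroot : μ ∈ (signlessLaplacian G).charpoly.roots) :
    (μ - 3) * ((Fintype.card V - 1) - (μ - 5) * (μ - (Fintype.card V - 1)))
      = 2 * ((Finset.univ.erase v₀).filter (G.degree · = 2)).card := by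
  obtain ⟨x, hx0, hx⟩ := exists_eigenvector_of_mem_roots hroot
  obtain ⟨a, -, h0, hx⟩ := hG.exists_normalized_eigenvector (Or.inr hμ) hx0 hx
  rw [← hG.sum_degree_two h0 hx, mul_left_comm, Finset.mul_sum, Finset.sum_congr rfl
    (g := fun _ => (1 : ℝ))]
  · simp
  intro v hv
  simp only [Finset.mem_filter, Finset.mem_erase, Finset.mem_univ, and_true] at hv
  obtain ⟨w, hw, hvw, -⟩ := hG.exists_unique_neighbor hv.1 hv.2
  exact (hG.eigen_path_end hμ h0 hx hv.1 hw hv.2 hvw).1 (hpath v w hv.1 hw hvw hv.2)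

/-- If the base consists of cycles and edges, an eigenvector for an eigenvalue `μ < 1` would be
constant on the cycles and on the edges, and the equation at the apex would fail. -/
lemma one_le_of_mem_roots (hcard : 3 ≤ Fintype.card V) (hpath : PathsAreEdges G v₀) {μ : ℝ}
    (hroot : μ ∈ (signlessLaplacian G).charpoly.roots) : 1 ≤ μ := by
  by_contra! hμ
  obtain ⟨x, hx0, hx⟩ := exists_eigenvector_of_mem_roots hroot
  obtain ⟨a, -, h0, hx⟩ := hG.exists_normalized_eigenvector (Or.inl hμ) hx0 hx
  set y := a • x
  let z : V → ℝ := fun v =>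
    if v = v₀ then 1 else if G.degree v = 2 then 1 / (μ - 3) else 1 / (μ - 5)
  have hz0 : z v₀ = 1 := by simp [z]
  have hz2 : ∀ v, v ≠ v₀ → G.degree v = 2 → z v = 1 / (μ - 3) := fun v hv hd => by simp [z, hv, hd]
  have hz3 : ∀ v, v ≠ v₀ → G.degree v = 3 → z v = 1 / (μ - 5) := fun v hv hd => by simp [z, hv, hd]
  have h3 : μ - 3 ≠ 0 := by linarith
  have h5 : μ - 5 ≠ 0 := by linarith
  have hz : ∀ v, v ≠ v₀ → (signlessLaplacian G *ᵥ z) v = μ * z v := by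
    intro v hv
    have hconst : ∀ u ∈ (G.neighborFinset v).erase v₀, z u = z v := by
      intro u hu
      simp only [Finset.mem_erase, SimpleGraph.mem_neighborFinset] at hu
      rcases hG.degree v hv with hd | hd
      · rw [hz2 v hv hd, hz2 u hu.1 (hpath v u hv hu.1 hu.2 hd)]
      · rcases hG.degree u hu.1 with hd' | hd'
        · rw [hpath u v hu.1 hv hu.2.symm hd'] at hd; omega
        · rw [hz3 v hv hd, hz3 u hu.1 hd']
    have hc : (((G.neighborFinset v).erase v₀).card : ℝ) = (G.degree v : ℝ) - 1 := by
      rw [← hG.card_erase hv]; simp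
    rw [hG.mulVec_apply hv, hz0, Finset.sum_congr rfl hconst, Finset.sum_const, nsmul_eq_mul, hc]
    rcases hG.degree v hv with hd | hd
    · rw [hz2 v hv hd, hd]; field_simp; push_cast; ring
    · rw [hz3 v hv hd, hd]; field_simp; push_cast; ring
  have hyz : y - z = 0 := by
    refine hG.eq_zero_of_eigen (Or.inl hμ) (by simp [h0, hz0]) fun v hv => ?_
    rw [mulVec_sub, Pi.sub_apply, Pi.sub_apply, hz v hv, hx, Pi.smul_apply, smul_eq_mul]; ring
  rw [sub_eq_zero] at hyz
  have h2 := congrFun hx v₀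
  rw [hG.mulVec_apex, Pi.smul_apply, smul_eq_mul, h0, hyz] at h2
  have hlow : ∀ v ∈ Finset.univ.erase v₀, (-(1 / 2) : ℝ) ≤ z v := by
    intro v hv
    rcases hG.degree v (Finset.ne_of_mem_erase hv) with hd | hd
    · rw [hz2 v (Finset.ne_of_mem_erase hv) hd, le_div_iff_of_neg (by linarith)]; linarith
    · rw [hz3 v (Finset.ne_of_mem_erase hv) hd, le_div_iff_of_neg (by linarith)]; linarith
  have h6 := Finset.card_nsmul_le_sum _ _ _ hlow
  rw [Finset.card_erase_of_mem (Finset.mem_univ _), Finset.card_univ, nsmul_eq_mul,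
    Nat.cast_sub (by omega)] at h6
  have : (3 : ℝ) ≤ Fintype.card V := by exact_mod_cast hcard
  push_cast at h6
  linarith

end IsCone

end Cone

/-! ### Decomposition into cycles and edges -/

section Decomposition

lemma disjointUnion_adj_mk {ι : Type*} {V : ι → Type*} {G : ∀ i, SimpleGraph (V i)} {i : ι}
    {a b : V i} : (disjointUnion G).Adj ⟨i, a⟩ ⟨i, b⟩ ↔ (G i).Adj a b := by
  constructor
  · rintro ⟨j, c, d, h, h1, h2⟩
    cases h1
    cases h2
    exact h
  · exact fun h => ⟨i, a, b, h, rfl, rfl⟩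

lemma fst_eq_of_disjointUnion_adj {ι : Type*} {V : ι → Type*} {G : ∀ i, SimpleGraph (V i)}
    {x y : Σ i, V i} (h : (disjointUnion G).Adj x y) : x.1 = y.1 := by
  obtain ⟨i, a, b, -, rfl, rfl⟩ := h
  rfl

/-- Parametrisations of the components by graphs of the family `K` assemble to an isomorphism with
a disjoint union of members of `K`. -/
lemma exists_iso_disjointUnion {V : Type*} [Finite V] {T : ℕ → Type} (K : ∀ n, SimpleGraph (T n))
    (P : ℕ → Prop) (F : SimpleGraph V)
    (h : ∀ v, ∃ n, P n ∧ ∃ f : T n → V, Function.Injective f ∧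
      Set.range f = (F.connectedComponentMk v).supp ∧
      ∀ i j, F.Adj (f i) (f j) ↔ (K n).Adj i j) :
    ∃ (m : ℕ) (s : Fin m → ℕ), (∀ i, P (s i)) ∧
      Nonempty (F ≃g disjointUnion fun i => K (s i)) := by
  have h' : ∀ c : F.ConnectedComponent, ∃ n, P n ∧ ∃ f : T n → V, Function.Injective f ∧
      Set.range f = c.supp ∧ ∀ i j, F.Adj (f i) (f j) ↔ (K n).Adj i j :=
    fun c => c.ind h
  choose n hP f hinj hrange hadj using h'
  obtain ⟨m, ⟨e⟩⟩ := Finite.exists_equiv_fin F.ConnectedComponent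
  refine ⟨m, fun i => n (e.symm i), fun i => hP _, ⟨SimpleGraph.Iso.symm ?_⟩⟩
  let φ : (Σ i : Fin m, T (n (e.symm i))) → V := fun x => f (e.symm x.1) x.2
  have hcomp : ∀ x, F.connectedComponentMk (φ x) = e.symm x.1 := fun x => by
    have : φ x ∈ (e.symm x.1).supp := by rw [← hrange]; exact ⟨_, rfl⟩
    exact this
  have hbij : Function.Bijective φ := by
    constructor
    · rintro ⟨i, a⟩ ⟨j, b⟩ hab
      have : i = j := by
        have h1 := hcomp ⟨i, a⟩
        rw [hab, hcomp ⟨j, b⟩] at h1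
        exact (e.symm.injective h1).symm
      subst this
      exact congrArg (Sigma.mk i) (hinj _ hab)
    · intro v
      obtain ⟨i, hi⟩ := e.symm.surjective (F.connectedComponentMk v)
      have : v ∈ Set.range (f (e.symm i)) := by rw [hrange, hi]; rfl
      obtain ⟨a, ha⟩ := this
      exact ⟨⟨i, a⟩, ha⟩
  refine ⟨Equiv.ofBijective φ hbij, ?_⟩
  rintro ⟨i, a⟩ ⟨j, b⟩
  constructor
  · intro hab
    have : i = j := by
      have h1 := SimpleGraph.ConnectedComponent.connectedComponentMk_eq_of_adj hab
      change F.connectedComponentMk (φ _) = F.connectedComponentMk (φ _) at h1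
      rw [hcomp, hcomp] at h1
      exact e.symm.injective h1
    subst this
    exact disjointUnion_adj_mk.2 ((hadj _ _ _).1 hab)
  · intro hab
    obtain rfl : i = j := fst_eq_of_disjointUnion_adj hab
    exact (hadj _ _ _).2
      ((disjointUnion_adj_mk (G := fun i => K (n (e.symm i)))).1 hab)

lemma cycleGraph_adj_iff_mod {n : ℕ} (hn : 3 ≤ n) (u v : Fin n) :
    (SimpleGraph.cycleGraph n).Adj u v ↔
      (u.val + 1) % n = v.val ∨ (v.val + 1) % n = u.val := by
  have key : ∀ a b : Fin n, (a - b).val = 1 ↔ (b.val + 1) % n = a.val := by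
    intro a b
    have ha := a.isLt
    have hb := b.isLt
    rw [Fin.sub_def]
    simp only
    rcases Nat.lt_or_ge (b.val + 1) n with h | h
    · rw [Nat.mod_eq_of_lt h]
      rcases Nat.lt_or_ge (n - b.val + a.val) n with h' | h'
      · rw [Nat.mod_eq_of_lt h']; omega
      · rw [Nat.mod_eq_sub_mod h', Nat.mod_eq_of_lt (by omega)]; omega
    · have : b.val + 1 = n := by omega
      rw [this, Nat.mod_self]
      rcases Nat.lt_or_ge (n - b.val + a.val) n with h' | h'
      · rw [Nat.mod_eq_of_lt h']; omega
      · rw [Nat.mod_eq_sub_mod h', Nat.mod_eq_of_lt (by omega)]; omega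
  rw [SimpleGraph.cycleGraph_adj', key, key, or_comm]

/-- A finite 2-regular graph is a disjoint union of cycles. -/
lemma exists_iso_disjointUnion_cycleGraph {V : Type*} [Finite V] (F : SimpleGraph V)
    (h : ∀ v, (F.neighborSet v).ncard = 2) : ∃ (m : ℕ) (s : Fin m → ℕ), (∀ i, 3 ≤ s i) ∧
      Nonempty (F ≃g disjointUnion fun i => SimpleGraph.cycleGraph (s i)) := by
  classical
  have : Fintype V := Fintype.ofFinite V
  refine exists_iso_disjointUnion (T := Fin) SimpleGraph.cycleGraph (3 ≤ ·) F fun v => ?_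
  have hcyc : F.IsCycles := fun w _ => h w
  obtain ⟨p, hp, hverts⟩ := hcyc.exists_cycle_toSubgraph_verts_eq_connectedComponentSupp
    (v := v) (c := F.connectedComponentMk v) rfl (Set.nonempty_of_ncard_ne_zero (by rw [h]; simp))
  have hlen := hp.three_le_length
  have hinj : ∀ i j, i < p.length → j < p.length → p.getVert i = p.getVert j → i = j :=
    fun i j hi hj hij => hp.getVert_injOn' (by simp only [Set.mem_ofPred_eq]; omega)
      (by simp only [Set.mem_ofPred_eq]; omega) hij
  have hmod : ∀ i, i < p.length → p.getVert (i + 1) = p.getVert ((i + 1) % p.length) := by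
    intro i hi
    rcases Nat.lt_or_ge (i + 1) p.length with h | h
    · rw [Nat.mod_eq_of_lt h]
    · rw [show i + 1 = p.length by omega, Nat.mod_self, p.getVert_length, p.getVert_zero]
  have hlt : ∀ i, i % p.length < p.length := fun i => Nat.mod_lt _ (by omega)
  refine ⟨p.length, hlen, fun i => p.getVert i, fun i j hij => Fin.ext
    (hinj _ _ i.isLt j.isLt hij), ?_, fun i j => ?_⟩
  · rw [← hverts]
    ext w
    rw [SimpleGraph.Walk.mem_verts_toSubgraph, SimpleGraph.Walk.mem_support_iff_exists_getVert]
    constructor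
    · rintro ⟨i, rfl⟩
      exact ⟨i, rfl, i.isLt.le⟩
    · rintro ⟨i, rfl, hi⟩
      rcases hi.lt_or_eq with hi | rfl
      · exact ⟨⟨i, hi⟩, rfl⟩
      · exact ⟨⟨0, by omega⟩, by simp⟩
  · have hmem : p.getVert i ∈ p.toSubgraph.verts := by
      rw [SimpleGraph.Walk.mem_verts_toSubgraph]; exact p.getVert_mem_support _
    rw [← hp.adj_toSubgraph_iff_of_isCycles hcyc hmem, SimpleGraph.Walk.toSubgraph_adj_iff,
      cycleGraph_adj_iff_mod hlen]
    simp only [Sym2.eq_iff]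
    constructor
    · rintro ⟨k, ⟨h1, h2⟩ | ⟨h1, h2⟩, hk⟩
      · rw [hmod k hk] at h2
        have e1 := hinj _ _ hk i.isLt h1
        have e2 := hinj _ _ (hlt _) j.isLt h2
        left; rw [← e1, e2]
      · rw [hmod k hk] at h2
        have e1 := hinj _ _ hk j.isLt h1
        have e2 := hinj _ _ (hlt _) i.isLt h2
        right; rw [← e1, e2]
    · rintro (h1 | h1)
      · exact ⟨i, Or.inl ⟨rfl, by rw [hmod _ i.isLt, h1]⟩, i.isLt⟩
      · exact ⟨j, Or.inr ⟨rfl, by rw [hmod _ j.isLt, h1]⟩, j.isLt⟩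

/-- A finite 1-regular graph is a disjoint union of edges. -/
lemma exists_iso_disjointUnion_top {V : Type*} [Finite V] (F : SimpleGraph V)
    (h : ∀ v, (F.neighborSet v).ncard = 1) : ∃ m : ℕ,
      Nonempty (F ≃g disjointUnion fun _ : Fin m => (⊤ : SimpleGraph (Fin 2))) := by
  refine (exists_iso_disjointUnion (T := fun _ => Fin 2) (fun _ => ⊤) (fun _ => True) F
    fun v => ?_).imp fun m ⟨_, _, e⟩ => e
  obtain ⟨w, hw⟩ := Set.ncard_eq_one.1 (h v)
  have hv : ∀ u, F.Adj v u ↔ u = w := fun u => by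
    rw [← SimpleGraph.mem_neighborSet, hw, Set.mem_singleton_iff]
  have hvw : F.Adj v w := (hv w).2 rfl
  have hw' : ∀ u, F.Adj w u ↔ u = v := by
    obtain ⟨x, hx⟩ := Set.ncard_eq_one.1 (h w)
    have hvx : v ∈ F.neighborSet w := hvw.symm
    rw [hx, Set.mem_singleton_iff] at hvx
    intro u
    rw [← SimpleGraph.mem_neighborSet, hx, Set.mem_singleton_iff, hvx]
  have hclosed : ∀ {a b : V}, F.Walk a b → (b = v ∨ b = w) → (a = v ∨ a = w) := by
    intro a b p
    induction p with
    | nil => exact id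
    | cons h p ih =>
      intro hb
      rcases ih hb with rfl | rfl
      · exact Or.inr ((hv _).1 h.symm)
      · exact Or.inl ((hw' _).1 h.symm)
  refine ⟨0, trivial, ![v, w], ?_, ?_, ?_⟩
  · intro i j hij
    fin_cases i <;> fin_cases j <;> simp [hvw.ne, hvw.ne'] at hij ⊢
  · ext u
    simp only [Matrix.range_cons, Matrix.range_empty, Set.union_empty, Set.mem_union,
      Set.mem_singleton_iff, SimpleGraph.ConnectedComponent.mem_supp_iff,
      SimpleGraph.ConnectedComponent.eq]
    constructor
    · rintro (rfl | rfl)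
      · rfl
      · exact hvw.reachable.symm
    · rintro ⟨p⟩
      exact hclosed p (Or.inl rfl)
  · intro i j
    fin_cases i <;> fin_cases j <;> simp [hv, hw']

/-- The isomorphism of `G` with the cone over the subgraphs that vertices of degree `3` and of
degree `2` induce in the base. -/
lemma IsCone.exists_iso_cyclesEdgesCone {V : Type*} [Fintype V] {G : SimpleGraph V} {v₀ : V}
    (hG : IsCone G v₀) (hpath : PathsAreEdges G v₀) :
    ∃ (m q : ℕ) (s : Fin m → ℕ), (∀ i, 3 ≤ s i) ∧ Nonempty (G ≃g cyclesEdgesCone s q) := by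
  classical
  let A := {v : V // v ≠ v₀ ∧ G.degree v = 3}
  let B := {v : V // v ≠ v₀ ∧ ¬ G.degree v = 3}
  have hB : ∀ v : B, G.degree v.1 = 2 := fun v => (hG.degree v.1 v.2.1).resolve_right v.2.2
  have hAB : ∀ (a : A) (b : B), ¬ G.Adj a.1 b.1 := fun a b hab => by
    have := hpath b.1 a.1 b.2.1 a.2.1 hab.symm (hB b)
    rw [a.2.2] at this; omega
  let FA : SimpleGraph A := G.comap Subtype.val
  let FB : SimpleGraph B := G.comap Subtype.val
  have hcard : ∀ (p : V → Prop) (v : V) (F : SimpleGraph {v : V // p v}) (k : ℕ),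
      F = G.comap Subtype.val → (hv : p v) → v ≠ v₀ → G.degree v = k + 1 →
      (∀ u, u ≠ v₀ → G.Adj v u → p u) → (¬ p v₀) → (F.neighborSet ⟨v, hv⟩).ncard = k := by
    intro p v F k hF hv hne hd hp hp₀
    have h1 := hG.card_erase hne
    rw [hd] at h1
    rw [← Set.ncard_image_of_injective _ Subtype.val_injective,
      show Subtype.val '' F.neighborSet ⟨v, hv⟩
        = ((G.neighborFinset v).erase v₀ : Finset V) from ?_,
      Set.ncard_coe_finset]
    · omega
    · ext u
      simp only [Set.mem_image, SimpleGraph.mem_neighborSet, Subtype.exists, Finset.mem_coe,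
        Finset.mem_erase, SimpleGraph.mem_neighborFinset, hF, SimpleGraph.comap_adj]
      constructor
      · rintro ⟨u', hu', h, rfl⟩
        exact ⟨fun e => hp₀ (e ▸ hu'), h⟩
      · rintro ⟨hu, h⟩
        exact ⟨u, hp u hu h, h, rfl⟩
  have hA2 : ∀ v, (FA.neighborSet v).ncard = 2 := fun v =>
    hcard _ v.1 FA 2 rfl v.2 v.2.1 v.2.2 (fun u hu hvu => ⟨hu, by
      by_contra h; exact hAB v ⟨u, hu, h⟩ hvu⟩) (by simp)
  have hB1 : ∀ v, (FB.neighborSet v).ncard = 1 := fun v =>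
    hcard _ v.1 FB 1 rfl v.2 v.2.1 (hB v) (fun u hu hvu => ⟨hu, fun h =>
      hAB ⟨u, hu, h⟩ v hvu.symm⟩) (by simp)
  obtain ⟨m, s, hs, ⟨eA⟩⟩ := exists_iso_disjointUnion_cycleGraph FA hA2
  obtain ⟨q, ⟨eB⟩⟩ := exists_iso_disjointUnion_top FB hB1
  refine ⟨m, q, s, hs, ⟨SimpleGraph.Iso.symm ?_⟩⟩
  let φ : Fin 1 ⊕ ((Σ i : Fin m, Fin (s i)) ⊕ (Σ _ : Fin q, Fin 2)) → V :=
    Sum.elim (fun _ => v₀) (Sum.elim (fun x => (eA.symm x).1) fun x => (eB.symm x).1)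
  have hbij : Function.Bijective φ := by
    constructor
    · rintro (a | a | a) (b | b | b) hab
      · rw [Subsingleton.elim a b]
      · exact absurd hab.symm (eA.symm b).2.1
      · exact absurd hab.symm (eB.symm b).2.1
      · exact absurd hab (eA.symm a).2.1
      · rw [eA.symm.injective (Subtype.ext hab)]
      · exact absurd ((show (eA.symm a).1 = (eB.symm b).1 from hab) ▸ (eA.symm a).2.2)
          (eB.symm b).2.2
      · exact absurd hab (eB.symm a).2.1
      · exact absurd ((show (eB.symm a).1 = (eA.symm b).1 from hab) ▸ (eA.symm b).2.2)
          (eB.symm a).2.2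
      · rw [eB.symm.injective (Subtype.ext hab)]
    · intro v
      by_cases hv : v = v₀
      · exact ⟨Sum.inl 0, hv.symm⟩
      · by_cases hd : G.degree v = 3
        · exact ⟨Sum.inr (Sum.inl (eA ⟨v, hv, hd⟩)), by simp [φ]⟩
        · exact ⟨Sum.inr (Sum.inr (eB ⟨v, hv, hd⟩)), by simp [φ]⟩
  refine ⟨Equiv.ofBijective φ hbij, ?_⟩
  have hAA : ∀ x y, G.Adj (eA.symm x).1 (eA.symm y).1 ↔
      (disjointUnion fun i => SimpleGraph.cycleGraph (s i)).Adj x y :=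
    fun x y => eA.symm.map_rel_iff'
  have hBB : ∀ x y, G.Adj (eB.symm x).1 (eB.symm y).1 ↔
      (disjointUnion fun _ : Fin q => (⊤ : SimpleGraph (Fin 2))).Adj x y :=
    fun x y => eB.symm.map_rel_iff'
  rintro (a | a | a) (b | b | b) <;>
    simp only [Equiv.ofBijective_apply, φ, Sum.elim_inl, Sum.elim_inr, cyclesEdgesCone, join]
  · simp [Subsingleton.elim a b]
  · simpa using hG.adj _ (eA.symm b).2.1
  · simpa using hG.adj _ (eB.symm b).2.1
  · simpa using (hG.adj _ (eA.symm a).2.1).symm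
  · simpa using hAA a b
  · simpa using hAB _ _
  · simpa using (hG.adj _ (eB.symm a).2.1).symm
  · simpa using fun h => hAB _ _ (SimpleGraph.Adj.symm h)
  · simpa using hBB a b

end Decomposition

/-! ### Joins, disjoint unions and their characteristic polynomials -/

section Operations

open scoped Classical

lemma degree_eq_sum {V : Type*} [Fintype V] (G : SimpleGraph V) (v : V)
    [Fintype (G.neighborSet v)] : G.degree v = ∑ u, if G.Adj v u then 1 else 0 := by
  rw [Finset.sum_boole, ← SimpleGraph.card_neighborFinset_eq_degree]
  simp only [Nat.cast_id]
  congr 1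
  ext u
  simp

lemma degree_disjointUnion {ι : Type*} [Fintype ι] {V : ι → Type*} [∀ i, Fintype (V i)]
    (G : ∀ i, SimpleGraph (V i)) (i : ι) (a : V i)
    [Fintype ((disjointUnion G).neighborSet ⟨i, a⟩)] [Fintype ((G i).neighborSet a)] :
    (disjointUnion G).degree ⟨i, a⟩ = (G i).degree a := by
  rw [degree_eq_sum, degree_eq_sum, Fintype.sum_sigma, Finset.sum_eq_single i]
  · simp [disjointUnion_adj_mk]
  · intro j _ hj
    refine Finset.sum_eq_zero fun b _ => if_neg fun h => hj (fst_eq_of_disjointUnion_adj h).symm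
  · simp

variable {V W : Type*} [Fintype V] [Fintype W] (F : SimpleGraph V) (F' : SimpleGraph W)

lemma degree_sum_inl (v : V) [Fintype ((F ⊕g F').neighborSet (Sum.inl v))]
    [Fintype (F.neighborSet v)] : (F ⊕g F').degree (Sum.inl v) = F.degree v := by
  simp only [degree_eq_sum, Fintype.sum_sum_type, SimpleGraph.sum_adj]
  simp

lemma degree_sum_inr (v : W) [Fintype ((F ⊕g F').neighborSet (Sum.inr v))]
    [Fintype (F'.neighborSet v)] : (F ⊕g F').degree (Sum.inr v) = F'.degree v := by
  simp only [degree_eq_sum, Fintype.sum_sum_type, SimpleGraph.sum_adj]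
  simp

lemma degree_join_apex
    [Fintype ((join (⊤ : SimpleGraph (Fin 1)) F).neighborSet (Sum.inl 0))] :
    (join (⊤ : SimpleGraph (Fin 1)) F).degree (Sum.inl 0) = Fintype.card V := by
  rw [degree_eq_sum, Fintype.sum_sum_type]
  simp [join]

lemma degree_join_base (v : V) [Fintype (F.neighborSet v)]
    [Fintype ((join (⊤ : SimpleGraph (Fin 1)) F).neighborSet (Sum.inr v))] :
    (join (⊤ : SimpleGraph (Fin 1)) F).degree (Sum.inr v) = F.degree v + 1 := by
  rw [degree_eq_sum, degree_eq_sum, Fintype.sum_sum_type]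
  simp [join, add_comm]

lemma signlessLaplacian_sum : signlessLaplacian (F ⊕g F')
    = fromBlocks (signlessLaplacian F) 0 0 (signlessLaplacian F') := by
  ext (i | i) (j | j) <;>
    simp [signlessLaplacian_apply, degree_sum_inl, degree_sum_inr]

/-- The effect of a cone on the characteristic polynomial: adding the multiples `y` of the other
columns to the first one clears it below the diagonal. -/
lemma eval_charpoly_join {μ : ℝ} {y : V → ℝ}
    (hy : ∀ v, (signlessLaplacian F *ᵥ y) v = (μ - 1) * y v - 1) :
    (qPoly (join (⊤ : SimpleGraph (Fin 1)) F)).eval μ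
      = (μ - Fintype.card V - ∑ v, y v) * (qPoly F).eval (μ - 1) := by
  rw [qPoly_eq, qPoly_eq, eval_charpoly, eval_charpoly]
  have h1 : scalar (Fin 1 ⊕ V) μ - signlessLaplacian (join (⊤ : SimpleGraph (Fin 1)) F)
      = fromBlocks (of fun _ _ => μ - Fintype.card V) (of fun _ _ => -1) (of fun _ _ => -1)
        (scalar V (μ - 1) - signlessLaplacian F) := by
    ext (i | i) (j | j)
    · rw [Subsingleton.elim i 0, Subsingleton.elim j 0]
      have h := degree_join_apex F
      simp [signlessLaplacian_apply, h]
    · simp [signlessLaplacian_apply, join]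
    · simp [signlessLaplacian_apply, join]
    · simp only [Matrix.sub_apply, scalar_apply, diagonal_apply, signlessLaplacian_apply,
        degree_join_base, fromBlocks_apply₂₂, Sum.inr.injEq]
      by_cases h : i = j
      · simp [h]; ring
      · simp [h, join]
  have h2 : (fromBlocks (of fun _ _ => μ - Fintype.card V) (of fun _ _ => -1) (of fun _ _ => -1)
        (scalar V (μ - 1) - signlessLaplacian F) : Matrix (Fin 1 ⊕ V) (Fin 1 ⊕ V) ℝ)
      * fromBlocks 1 0 (of fun v _ => y v) 1
      = fromBlocks (of fun _ _ => μ - Fintype.card V - ∑ v, y v) (of fun _ _ => -1) 0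
        (scalar V (μ - 1) - signlessLaplacian F) := by
    rw [fromBlocks_multiply]
    congr 1
    · ext i j
      rw [Subsingleton.elim i 0, Subsingleton.elim j 0]
      simp [mul_apply, sub_eq_add_neg]
    · simp
    · ext v j
      rw [Subsingleton.elim j 0]
      have := hy v
      simp only [mulVec, dotProduct] at this
      simp [mul_apply, sub_mul, Finset.sum_sub_distrib, this, diagonal_apply]
    · simp
  have h3 := congrArg det h2
  rw [det_mul, det_fromBlocks_zero₁₂, det_fromBlocks_zero₂₁] at h3
  rw [det_one, det_one, mul_one, mul_one, det_unique (of _), of_apply] at h3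
  rw [h1, h3]

end Operations

section CyclesEdgesCone

open scoped Classical

lemma degree_cycleGraph {n : ℕ} (hn : 3 ≤ n) (v : Fin n)
    [Fintype ((SimpleGraph.cycleGraph n).neighborSet v)] :
    (SimpleGraph.cycleGraph n).degree v = 2 := by
  obtain ⟨k, rfl⟩ := Nat.exists_eq_add_of_le' hn
  convert SimpleGraph.cycleGraph_degree_three_le (v := v)

variable {t q : ℕ} {s : Fin t → ℕ}

/-- The disjoint union of the cycles `C_{s i}`. -/
abbrev cycles (s : Fin t → ℕ) : SimpleGraph (Σ i : Fin t, Fin (s i)) :=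
  disjointUnion fun i => SimpleGraph.cycleGraph (s i)

/-- The disjoint union of `q` copies of `K₂`. -/
abbrev edges (q : ℕ) : SimpleGraph (Σ _ : Fin q, Fin 2) :=
  disjointUnion fun _ => ⊤

lemma degree_cycles (hs : ∀ i, 3 ≤ s i) (x : Σ i : Fin t, Fin (s i)) :
    (cycles s).degree x = 2 := by
  obtain ⟨i, a⟩ := x
  rw [degree_disjointUnion, degree_cycleGraph (hs i)]

lemma degree_edges (x : Σ _ : Fin q, Fin 2) : (edges q).degree x = 1 := by
  obtain ⟨i, a⟩ := x
  rw [degree_disjointUnion, degree_eq_sum]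
  fin_cases a <;> simp

lemma cyclesEdgesCone_eq : cyclesEdgesCone s q
    = join (⊤ : SimpleGraph (Fin 1)) (cycles s ⊕g edges q) := rfl

lemma degree_cyclesEdgesCone_apex :
    (cyclesEdgesCone s q).degree (Sum.inl 0) = (∑ i, s i) + 2 * q := by
  rw [cyclesEdgesCone_eq, degree_join_apex]
  simp [mul_comm]

lemma degree_cyclesEdgesCone_cycle (hs : ∀ i, 3 ≤ s i) (x : Σ i : Fin t, Fin (s i)) :
    (cyclesEdgesCone s q).degree (Sum.inr (Sum.inl x)) = 3 := by
  rw [cyclesEdgesCone_eq, degree_join_base, degree_sum_inl, degree_cycles hs]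

lemma degree_cyclesEdgesCone_edge (x : Σ _ : Fin q, Fin 2) :
    (cyclesEdgesCone s q).degree (Sum.inr (Sum.inr x)) = 2 := by
  rw [cyclesEdgesCone_eq, degree_join_base, degree_sum_inr, degree_edges]

lemma sum_degree_cyclesEdgesCone (hs : ∀ i, 3 ≤ s i) (f : ℕ → ℝ) :
    ∑ v, f ((cyclesEdgesCone s q).degree v)
      = f ((∑ i, s i) + 2 * q) + (∑ i, s i : ℕ) * f 3 + 2 * q * f 2 := by
  rw [Fintype.sum_sum_type, Fintype.sum_sum_type]
  simp only [degree_cyclesEdgesCone_cycle hs, degree_cyclesEdgesCone_edge,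
    Fin.isValue, Finset.univ_unique, Fin.default_eq_zero, Finset.sum_singleton,
    degree_cyclesEdgesCone_apex, Finset.sum_const, Finset.card_univ, Fintype.card_sigma,
    Fintype.card_fin, nsmul_eq_mul]
  push_cast
  ring

lemma isCone_cyclesEdgesCone (hs : ∀ i, 3 ≤ s i) :
    IsCone (cyclesEdgesCone s q) (Sum.inl 0) where
  adj := by
    rintro (a | a) h
    · exact absurd (congrArg Sum.inl (Subsingleton.elim a 0)) h
    · simp [cyclesEdgesCone, join]
  degree := by
    rintro (a | a | a) h
    · exact absurd (congrArg Sum.inl (Subsingleton.elim a 0)) h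
    · exact Or.inr (degree_cyclesEdgesCone_cycle hs a)
    · exact Or.inl (degree_cyclesEdgesCone_edge a)

lemma pathsAreEdges_cyclesEdgesCone (hs : ∀ i, 3 ≤ s i) :
    PathsAreEdges (cyclesEdgesCone s q) (Sum.inl 0) := by
  rintro (a | a | a) (b | b | b) ha hb hab hd
  · exact absurd (congrArg Sum.inl (Subsingleton.elim a 0)) ha
  · exact absurd (congrArg Sum.inl (Subsingleton.elim a 0)) ha
  · exact absurd (congrArg Sum.inl (Subsingleton.elim a 0)) ha
  · exact absurd (congrArg Sum.inl (Subsingleton.elim b 0)) hb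
  · rw [degree_cyclesEdgesCone_cycle hs] at hd; omega
  · exact degree_cyclesEdgesCone_edge b
  · exact absurd (congrArg Sum.inl (Subsingleton.elim b 0)) hb
  · simp [cyclesEdgesCone, join] at hab
  · exact degree_cyclesEdgesCone_edge b

/-- On a union of regular graphs the system to be solved has a solution that is constant on each
of them. -/
lemma eval_charpoly_cyclesEdgesCone (hs : ∀ i, 3 ≤ s i) {μ : ℝ} (h3 : μ ≠ 3) (h5 : μ ≠ 5) :
    (qPoly (cyclesEdgesCone s q)).eval μ
      = (μ - ((∑ i, s i : ℕ) + 2 * q) - ((∑ i, s i : ℕ) / (μ - 5) + 2 * q / (μ - 3)))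
        * (qPoly (edges q)).eval (μ - 1)
        * (qPoly (cycles s)).eval (μ - 1) := by
  have h3' := sub_ne_zero.2 h3
  have h5' := sub_ne_zero.2 h5
  rw [cyclesEdgesCone_eq, eval_charpoly_join (y := Sum.elim (fun _ => 1 / (μ - 5))
    fun _ => 1 / (μ - 3)), qPoly_eq, signlessLaplacian_sum,
    charpoly_fromBlocks_zero₁₂, ← qPoly_eq, ← qPoly_eq, eval_mul,
    mul_comm (eval _ _), ← mul_assoc]
  · congr 3
    · simp; ring
    · simp; ring
  · rintro (v | v)
    · rw [signlessLaplacian_sum, fromBlocks_mulVec]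
      simp only [Sum.elim_inl, zero_mulVec, add_zero, Function.comp_def, Sum.elim_inr]
      rw [signlessLaplacian_mulVec_apply, Finset.sum_const,
        SimpleGraph.card_neighborFinset_eq_degree, degree_cycles hs]
      simp; field_simp; ring
    · rw [signlessLaplacian_sum, fromBlocks_mulVec]
      simp only [Sum.elim_inl, zero_mulVec, zero_add, Function.comp_def, Sum.elim_inr]
      rw [signlessLaplacian_mulVec_apply, Finset.sum_const,
        SimpleGraph.card_neighborFinset_eq_degree, degree_edges]
      simp; field_simp; ring

lemma QCospectral.card_edges_eq {t' q' : ℕ} {s' : Fin t' → ℕ} (hs : ∀ i, 3 ≤ s i)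
    (hs' : ∀ i, 3 ≤ s' i) (h : QCospectral (cyclesEdgesCone s' q') (cyclesEdgesCone s q)) :
    q' = q := by
  have hcard := h.card_eq
  simp only [Fintype.card_sum, Fintype.card_sigma, Fintype.card_fin, Finset.sum_const,
    Finset.card_univ, smul_eq_mul] at hcard
  have hdeg := h.sum_degree_eq
  rw [sum_degree_cyclesEdgesCone hs fun d => (d : ℝ),
    sum_degree_cyclesEdgesCone hs' fun d => (d : ℝ)] at hdeg
  norm_cast at hdeg
  omega

/-- Cospectral cones have cospectral unions of cycles. -/
lemma QCospectral.qPoly_cycles_eq {t' q' : ℕ} {s' : Fin t' → ℕ} (hs : ∀ i, 3 ≤ s i)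
    (hs' : ∀ i, 3 ≤ s' i) (h : QCospectral (cyclesEdgesCone s' q') (cyclesEdgesCone s q)) :
    qPoly (cycles s') = qPoly (cycles s) := by
  obtain rfl := h.card_edges_eq hs hs'
  have hS : ∑ i, s' i = ∑ i, s i := by
    have hcard := h.card_eq
    simp only [Fintype.card_sum, Fintype.card_sigma, Fintype.card_fin] at hcard
    omega
  set N : ℝ := (∑ i, s i : ℕ) + 2 * q' with hN
  have hmonic : (qPoly (edges q')).Monic := by
    rw [QSpectra.qPoly_eq]; exact charpoly_monic _
  -- outside this finite set of exceptions, the factors of `eval_charpoly_cyclesEdgesCone` that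
  -- depend on `∑ i, s i` and `q` only are nonzero and may be cancelled
  refine eq_of_infinite_eval_eq _ _
    (((Set.Ioi_infinite (2 * N + 6)).sdiff (qPoly (edges q')).roots.toFinset.finite_toSet).mono ?_)
  rintro x ⟨hx, hroot⟩
  have hx' : 2 * N + 6 < x := hx
  have hS0 : (0 : ℝ) ≤ (∑ i, s i : ℕ) := Nat.cast_nonneg _
  have hq0 : (0 : ℝ) ≤ q' := Nat.cast_nonneg _
  have h1 := eval_charpoly_cyclesEdgesCone (q := q') hs (μ := x + 1) (by linarith) (by linarith)
  have h2 := eval_charpoly_cyclesEdgesCone (q := q') hs' (μ := x + 1) (by linarith) (by linarith)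
  rw [h.qPoly_eq, h1, hS, add_sub_cancel_right] at h2
  refine (mul_left_cancel₀ (mul_ne_zero ?_ ?_) h2).symm
  · have e1 : ((∑ i, s i : ℕ) : ℝ) / (x + 1 - 5) ≤ (∑ i, s i : ℕ) :=
      div_le_self hS0 (by linarith)
    have e2 : 2 * (q' : ℝ) / (x + 1 - 3) ≤ 2 * q' := div_le_self (by linarith) (by linarith)
    linarith
  · intro h0
    exact hroot (by simpa [hmonic.ne_zero] using h0)

end CyclesEdgesCone

/-! ### Recovering the cycle lengths -/

section CycleLengths

/-- The identity `C_k(z + z⁻¹) = z^k + z^{-k}`. -/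
lemma aeval_chebyshevC {R : Type*} [Ring R] [Algebra ℝ R] {a b : R} (hab : a * b = 1)
    (hba : b * a = 1) (k : ℕ) :
    aeval (a + b) (Chebyshev.C ℝ (k : ℤ)) = a ^ k + b ^ k := by
  induction k using Nat.twoStepInduction with
  | zero => simp [Chebyshev.C_zero, one_add_one_eq_two, map_ofNat (aeval (a + b)) 2]
  | one => simp [Chebyshev.C_one]
  | more k h1 h2 =>
    push_cast at h2 ⊢
    rw [Chebyshev.C_add_two, map_sub, map_mul, aeval_X, h1, h2, add_mul, mul_add, mul_add,
      pow_succ' a (k + 1), pow_succ' b (k + 1), pow_succ' a k, pow_succ' b k]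
    simp only [← mul_assoc, hab, hba, one_mul]
    abel

/-- The rotation of each cycle of a disjoint union of cycles by one step. -/
def rotation {t : ℕ} (s : Fin t → ℕ) : Equiv.Perm (Σ i : Fin t, Fin (s i)) :=
  Equiv.sigmaCongrRight fun i => finRotate (s i)

variable {t : ℕ} {s : Fin t → ℕ}

lemma val_finRotate {n : ℕ} (a : Fin n) : (finRotate n a).val = (a.val + 1) % n := by
  cases n with
  | zero => exact a.elim0
  | succ n => rw [finRotate_apply, Fin.val_add, Fin.val_one', Nat.add_mod_mod]

lemma rotation_pow_apply (k : ℕ) (i : Fin t) (a : Fin (s i)) :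
    (rotation s ^ k) ⟨i, a⟩ = ⟨i, ⟨(a.val + k) % s i, Nat.mod_lt _ a.pos⟩⟩ := by
  induction k with
  | zero => simp [Nat.mod_eq_of_lt a.isLt]
  | succ k ih =>
    rw [pow_succ', Equiv.Perm.mul_apply, ih]
    change (⟨i, finRotate (s i) _⟩ : Σ i : Fin t, Fin (s i)) = _
    congr 1
    ext
    rw [val_finRotate]
    simp [← add_assoc]

lemma rotation_pow_apply_eq_iff (k : ℕ) (x : Σ i : Fin t, Fin (s i)) :
    (rotation s ^ k) x = x ↔ s x.1 ∣ k := by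
  obtain ⟨i, a⟩ := x
  rw [rotation_pow_apply, Nat.dvd_iff_mod_eq_zero]
  simp only [Sigma.mk.injEq, heq_eq_eq, true_and, Fin.ext_iff]
  have ha := a.isLt
  constructor
  · intro h
    have : (a.val + k) ≡ a.val + 0 [MOD s i] := by
      rw [Nat.ModEq, h, add_zero, Nat.mod_eq_of_lt ha]
    exact Nat.ModEq.add_left_cancel' _ this
  · intro h
    rw [Nat.add_mod, h, add_zero, Nat.mod_mod, Nat.mod_eq_of_lt ha]

open scoped Classical in
/-- The adjacency relation of a union of cycles is that of a permutation and its inverse. -/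
lemma cycles_adj_iff (hs : ∀ i, 3 ≤ s i) (x y : Σ i : Fin t, Fin (s i)) :
    (cycles s).Adj x y ↔ rotation s x = y ∨ rotation s y = x := by
  obtain ⟨i, a⟩ := x
  obtain ⟨j, b⟩ := y
  by_cases hij : i = j
  · subst hij
    rw [disjointUnion_adj_mk, cycleGraph_adj_iff_mod (hs i), ← val_finRotate, ← val_finRotate]
    simp [rotation, Fin.ext_iff]
  · constructor
    · exact fun h => absurd (fst_eq_of_disjointUnion_adj h) hij
    · rintro (h | h)
      · exact absurd (congrArg Sigma.fst h) hij
      · exact absurd (congrArg Sigma.fst h).symm hij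

open scoped Classical in
lemma signlessLaplacian_cycles (hs : ∀ i, 3 ≤ s i) : signlessLaplacian (cycles s)
    = (rotation s).permMatrix ℝ + (rotation s)⁻¹.permMatrix ℝ + 2 := by
  have h2 : ∀ x, rotation s (rotation s x) ≠ x := by
    intro x h
    have := (rotation_pow_apply_eq_iff 2 x).1 (by rw [sq]; exact h)
    have := Nat.le_of_dvd (by norm_num) this
    have := hs x.1
    omega
  ext x y
  have htwo : (2 : Matrix (Σ i : Fin t, Fin (s i)) (Σ i : Fin t, Fin (s i)) ℝ) x y
      = if x = y then 2 else 0 := by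
    rw [← diagonal_ofNat, diagonal_apply]
  rw [signlessLaplacian_apply, degree_cycles hs, Matrix.add_apply, Matrix.add_apply, htwo]
  simp only [cycles_adj_iff hs, Equiv.Perm.permMatrix, PEquiv.toMatrix_apply,
    Equiv.toPEquiv_apply, Option.mem_some_iff, Nat.cast_ofNat, Equiv.Perm.inv_eq_iff_eq]
  congr 1
  by_cases h : rotation s x = y
  · subst h
    simp [h2 x, (h2 x).symm]
  · simp [h, eq_comm]

open scoped Classical in
lemma trace_aeval_signlessLaplacian_cycles (hs : ∀ i, 3 ≤ s i) (k : ℕ) :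
    (aeval (signlessLaplacian (cycles s)) ((Chebyshev.C ℝ (k : ℤ)).comp (X - 2))).trace
      = 2 * ∑ i, if s i ∣ k then (s i : ℝ) else 0 := by
  have htrace : ∀ σ : Equiv.Perm (Σ i : Fin t, Fin (s i)), (∀ x, σ x = x ↔ s x.1 ∣ k) →
      (σ.permMatrix ℝ).trace = ∑ i, if s i ∣ k then (s i : ℝ) else 0 := by
    intro σ hσ
    rw [Matrix.trace, Fintype.sum_sigma]
    refine Finset.sum_congr rfl fun i _ => ?_
    simp [PEquiv.toMatrix_apply, hσ]
  have hpow : ∀ (σ : Equiv.Perm (Σ i : Fin t, Fin (s i))) (k : ℕ),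
      σ.permMatrix ℝ ^ k = (σ ^ k).permMatrix ℝ := by
    intro σ k
    induction k with
    | zero => simp
    | succ k ih => rw [pow_succ, pow_succ', permMatrix_mul, ih]
  rw [aeval_comp, map_sub, aeval_X, map_ofNat, signlessLaplacian_cycles hs, add_sub_cancel_right,
    aeval_chebyshevC (by rw [← permMatrix_mul]; simp) (by rw [← permMatrix_mul]; simp), hpow, hpow,
    trace_add, htrace _ (rotation_pow_apply_eq_iff k), htrace, two_mul]
  intro x
  rw [← rotation_pow_apply_eq_iff, inv_pow, Equiv.Perm.inv_eq_iff_eq, eq_comm]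

open scoped Classical in
lemma sum_ite_dvd_eq_of_qPoly_cycles_eq {t' : ℕ} {s' : Fin t' → ℕ} (hs : ∀ i, 3 ≤ s i)
    (hs' : ∀ i, 3 ≤ s' i) (h : qPoly (cycles s') = qPoly (cycles s)) (k : ℕ) :
    ∑ i, (if s' i ∣ k then s' i else 0) = ∑ i, if s i ∣ k then s i else 0 := by
  have h1 := trace_aeval_signlessLaplacian_cycles hs k
  have h2 := trace_aeval_signlessLaplacian_cycles hs' k
  rw [trace_aeval_eq_sum_roots (isHermitian_signlessLaplacian _), ← qPoly_eq] at h1 h2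
  rw [h, h1] at h2
  have h3 := mul_left_cancel₀ two_ne_zero h2
  exact_mod_cast h3.symm

lemma sum_ite_dvd_eq_sum_divisors {ι : Type*} [Fintype ι] (f : ι → ℕ) {k : ℕ} (hk : 0 < k) :
    ∑ i, (if f i ∣ k then f i else 0)
      = ∑ d ∈ k.divisors, d * (Finset.univ.filter (f · = d)).card := by
  have : ∀ d, d * (Finset.univ.filter (f · = d)).card = ∑ i, if f i = d then d else 0 := by
    intro d
    rw [← Finset.sum_filter, Finset.sum_const, smul_eq_mul, mul_comm]
  simp only [this]
  rw [Finset.sum_comm]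
  refine Finset.sum_congr rfl fun i _ => ?_
  rw [Finset.sum_ite_eq]
  simp [hk.ne']

/-- The sums of the lengths dividing `k` determine, by induction on `k` along divisibility, how
often each length occurs. -/
lemma card_eq_of_sum_ite_dvd_eq {ι κ : Type*} [Fintype ι] [Fintype κ] {f : ι → ℕ} {g : κ → ℕ}
    (hf : ∀ i, 0 < f i) (hg : ∀ i, 0 < g i)
    (h : ∀ k, ∑ i, (if f i ∣ k then f i else 0) = ∑ i, if g i ∣ k then g i else 0) (k : ℕ) :
    (Finset.univ.filter (f · = k)).card = (Finset.univ.filter (g · = k)).card := by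
  induction k using Nat.strong_induction_on with
  | _ k ih =>
    rcases Nat.eq_zero_or_pos k with rfl | hk
    · rw [Finset.filter_false_of_mem fun i _ => (hf i).ne',
        Finset.filter_false_of_mem fun i _ => (hg i).ne']
      rfl
    · have := h k
      rw [sum_ite_dvd_eq_sum_divisors f hk, sum_ite_dvd_eq_sum_divisors g hk,
        ← Nat.cons_self_properDivisors hk.ne', Finset.sum_cons,
        Finset.sum_cons,
        Finset.sum_congr rfl fun d hd => by rw [ih d (Nat.mem_properDivisors.1 hd).2]] at this
      exact Nat.eq_of_mul_eq_mul_left hk (Nat.add_right_cancel this)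

lemma nonempty_iso_of_card_eq {t' : ℕ} {s' : Fin t' → ℕ} (q : ℕ)
    (h : ∀ k, (Finset.univ.filter (s' · = k)).card = (Finset.univ.filter (s · = k)).card) :
    Nonempty (cyclesEdgesCone s' q ≃g cyclesEdgesCone s q) := by
  have h' : ∀ k, Nonempty ({i // s' i = k} ≃ {i // s i = k}) := fun k =>
    ⟨Fintype.equivOfCardEq (by rw [Fintype.card_subtype, Fintype.card_subtype, h])⟩
  let e : Fin t' ≃ Fin t := Equiv.ofFiberEquiv fun k => (h' k).some
  have he : s' = fun i => s (e i) := funext fun i =>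
    (Equiv.ofFiberEquiv_map (fun k => (h' k).some) i).symm
  clear_value e
  subst he
  refine ⟨⟨Equiv.sumCongr (Equiv.refl _)
    (Equiv.sumCongr (Equiv.sigmaCongrLeft (β := fun i => Fin (s i)) e) (Equiv.refl _)), ?_⟩⟩
  have key : ∀ x y : Σ i, Fin (s (e i)),
      (cycles s).Adj (Equiv.sigmaCongrLeft (β := fun i => Fin (s i)) e x)
        (Equiv.sigmaCongrLeft (β := fun i => Fin (s i)) e y)
      ↔ (cycles fun i => s (e i)).Adj x y := by
    rintro ⟨i, a⟩ ⟨j, b⟩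
    rw [Equiv.sigmaCongrLeft_apply, Equiv.sigmaCongrLeft_apply]
    by_cases hij : i = j
    · subst hij
      rw [disjointUnion_adj_mk, disjointUnion_adj_mk]
    · exact ⟨fun h => absurd (e.injective (fst_eq_of_disjointUnion_adj h)) hij,
        fun h => absurd (fst_eq_of_disjointUnion_adj h) hij⟩
  rintro (x | x | x) (y | y | y)
  all_goals simp [cyclesEdgesCone, join]
  exact key x y

open scoped Classical in
lemma nonempty_iso_of_qCospectral {t' q q' : ℕ} {s' : Fin t' → ℕ} (hs : ∀ i, 3 ≤ s i)
    (hs' : ∀ i, 3 ≤ s' i) (h : QCospectral (cyclesEdgesCone s' q') (cyclesEdgesCone s q)) :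
    Nonempty (cyclesEdgesCone s' q' ≃g cyclesEdgesCone s q) := by
  obtain rfl := h.card_edges_eq hs hs'
  refine nonempty_iso_of_card_eq q' (card_eq_of_sum_ite_dvd_eq ?_ ?_
    (sum_ite_dvd_eq_of_qPoly_cycles_eq hs hs' (h.qPoly_cycles_eq hs hs')))
  · exact fun i => by have := hs' i; omega
  · exact fun i => by have := hs i; omega

end CycleLengths

/-! ### Graphs cospectral with a cone over cycles and edges -/

section Recognition

open scoped Classical

lemma IsCone.card_degree_two {V : Type*} [Fintype V] {G : SimpleGraph V} {v₀ : V}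
    (hG : IsCone G v₀) : (((Finset.univ.erase v₀).filter (G.degree · = 2)).card : ℝ)
      = 4 * (Fintype.card V - 1) - ∑ v, (G.degree v : ℝ) := by
  rw [← Finset.add_sum_erase _ _ (Finset.mem_univ v₀), hG.degree_apex]
  have h : ∑ v ∈ Finset.univ.erase v₀, (3 - (G.degree v : ℝ))
      = ((Finset.univ.erase v₀).filter (G.degree · = 2)).card := by
    rw [Finset.card_filter, Nat.cast_sum]
    refine Finset.sum_congr rfl fun v hv => ?_
    rcases hG.degree v (Finset.ne_of_mem_erase hv) with h | h <;> rw [h] <;> norm_num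
  rw [Finset.sum_sub_distrib, Finset.sum_const, Finset.card_erase_of_mem (Finset.mem_univ _),
    Finset.card_univ, nsmul_eq_mul, Nat.cast_sub (Fintype.card_pos_iff.2 ⟨v₀⟩), Nat.cast_one] at h
  linarith

variable {t q : ℕ} {s : Fin t → ℕ} {W : Type*} [Fintype W] {H : SimpleGraph W}

/-- A graph cospectral with `K₁ ∨ (C_{s₁} ∪ ⋯ ∪ C_{sₜ} ∪ qK₂)` is a cone over a graph with degrees
`1` and `2`. -/
lemma QCospectral.exists_isCone (hs : ∀ i, 3 ≤ s i) (hn : 51 ≤ (∑ i, s i) + 2 * q)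
    (h : QCospectral H (cyclesEdgesCone s q)) : ∃ v₀, IsCone H v₀ := by
  have hG := isCone_cyclesEdgesCone (q := q) hs
  have hcardG : Fintype.card (Fin 1 ⊕ ((Σ i : Fin t, Fin (s i)) ⊕ (Σ _ : Fin q, Fin 2)))
      = (∑ i, s i) + 2 * q + 1 := by
    simp; ring
  have hcard := h.card_eq.trans hcardG
  have hcardR : (Fintype.card W : ℝ) = (∑ i, s i : ℕ) + 2 * q + 1 := by
    rw [hcard]; push_cast; ring
  have h1 : ∑ v, (H.degree v : ℝ) = _ :=
    h.sum_degree_eq.trans (sum_degree_cyclesEdgesCone hs fun d => (d : ℝ))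
  have h2 : ∑ v, (H.degree v : ℝ) ^ 2 = _ :=
    h.sum_degree_sq_eq.trans (sum_degree_cyclesEdgesCone hs fun d => (d : ℝ) ^ 2)
  have hle1 := hG.card_roots_le_one
  have hge1 := fun μ => hG.one_le_of_mem_roots (by rw [hcardG]; omega)
    (pathsAreEdges_cyclesEdgesCone hs) (μ := μ)
  rw [← h.roots_eq] at hle1 hge1
  have hnR : (51 : ℝ) ≤ (∑ i, s i : ℕ) + 2 * q := by exact_mod_cast hn
  have hS0 : (0 : ℝ) ≤ (∑ i, s i : ℕ) := Nat.cast_nonneg _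
  have hq0 : (0 : ℝ) ≤ q := Nat.cast_nonneg _
  push_cast at h1 h2 hcardR hnR hS0
  set S : ℝ := ∑ i, (s i : ℝ) with hS
  -- the ratio of `∑ d²` and `∑ d` bounds the maximum degree from below
  obtain ⟨v₀, hv₀⟩ : ∃ v₀, 15 ≤ H.degree v₀ := by
    by_contra! hcon
    have : ∑ v, (H.degree v : ℝ) ^ 2 ≤ 14 * ∑ v, (H.degree v : ℝ) := by
      rw [Finset.mul_sum]
      refine Finset.sum_le_sum fun v _ => ?_
      have hd : (H.degree v : ℝ) ≤ 14 := by exact_mod_cast Nat.le_of_lt_succ (hcon v)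
      rw [sq]
      exact mul_le_mul_of_nonneg_right hd (Nat.cast_nonneg _)
    rw [h1, h2] at this
    nlinarith
  have hdeg : ∀ v, 2 ≤ H.degree v := two_le_degree fun z => by
    have := le_dotProduct_mulVec_of_le_roots (isHermitian_signlessLaplacian H) hge1 z
    rwa [one_mul] at this
  have hdeg' : ∀ v, v ≠ v₀ → H.degree v ≤ 4 := fun v hv => degree_le_four hv hv₀ hdeg hle1
  have hsum2 : ∑ v, ((H.degree v : ℝ) - 2) = (Fintype.card W - 3) + S := by
    rw [Finset.sum_sub_distrib, h1, Finset.sum_const, Finset.card_univ, nsmul_eq_mul, hcardR]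
    ring
  have hsum23 : ∑ v, ((H.degree v : ℝ) - 2) * ((H.degree v : ℝ) - 3)
      = (Fintype.card W - 3) * (Fintype.card W - 4) := by
    have : ∀ d : ℝ, (d - 2) * (d - 3) = d ^ 2 - 5 * d + 6 := fun d => by ring
    simp only [this]
    rw [Finset.sum_add_distrib, Finset.sum_sub_distrib, ← Finset.mul_sum, h1, h2,
      Finset.sum_const, Finset.card_univ, nsmul_eq_mul, hcardR]
    ring
  obtain ⟨ha, hb⟩ := degree_eq_of_sums (by omega) (by linarith) hv₀ hdeg hdeg' hsum2 hsum23
  exact ⟨v₀, ha, hb⟩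

/-- A cone cospectral with a cone over cycles and edges is itself one, as both have the same
spectral radius. -/
lemma QCospectral.pathsAreEdges {V : Type*} [Fintype V] {G : SimpleGraph V} {v₀ : V} {w₀ : W}
    (hG : IsCone G v₀) (hpath : PathsAreEdges G v₀) (hcard : 7 ≤ Fintype.card V)
    (hH : IsCone H w₀) (h : QCospectral H G) : PathsAreEdges H w₀ := by
  obtain ⟨μ, hμ, hle⟩ := exists_root_ge_diag (isHermitian_signlessLaplacian G) v₀
  have hcardR : (7 : ℝ) ≤ Fintype.card V := by exact_mod_cast hcard
  rw [signlessLaplacian_apply_self, hG.degree_apex] at hle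
  have h5 : 5 < μ := by linarith
  refine hH.pathsAreEdges_of_mem_roots h5 (h.roots_eq ▸ hμ) ?_
  rw [hH.card_degree_two, h.sum_degree_eq, h.card_eq, ← hG.card_degree_two]
  exact hG.eq_of_mem_roots h5 hpath hμ

end Recognition

end QSpectra

theorem theorem1p2 (t q : ℕ) (s : Fin t → ℕ) (ht : 2 ≤ t) (hs : ∀ i, 3 ≤ s i)
    (hn : 52 ≤ Fintype.card (Fin 1 ⊕ ((Σ i : Fin t, Fin (s i)) ⊕ (Σ _ : Fin q, Fin 2)))) :
    QSpectra.IsDQS.{0, w} (QSpectra.cyclesEdgesCone s q) := by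
  intro W _ H h
  have hn' : 51 ≤ (∑ i, s i) + 2 * q := by
    simp at hn; omega
  obtain ⟨w₀, hH⟩ := h.exists_isCone hs hn'
  have hpath := h.pathsAreEdges (QSpectra.isCone_cyclesEdgesCone hs)
    (QSpectra.pathsAreEdges_cyclesEdgesCone hs) (by omega) hH
  obtain ⟨m, q', s', hs', ⟨e⟩⟩ := hH.exists_iso_cyclesEdgesCone hpath
  have h' : QSpectra.QCospectral (QSpectra.cyclesEdgesCone s' q')
      (QSpectra.cyclesEdgesCone s q) := (QSpectra.QCospectral.of_iso e).symm.trans h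
  obtain ⟨e'⟩ := QSpectra.nonempty_iso_of_qCospectral hs hs' h'
  exact ⟨e.trans e'⟩
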